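/- **Setting.** Let $a<b$, $n=(n_0,\dots,n_N)\in\mathbb N^{N+1}$, $n_{\hat x}=\sum_i n_i$, $n_S=\sum_{i=1}^N i\,n_i$. Let $W_k=W_k[a,b]$ be the $L_2$-Sobolev space of order $k$, and $W^n=\prod_{i=0}^N W_i^{n_i}$. For $\hat x=(\hat x_0,\dots,\hat x_N)\in W^n$ put $\mathcal F\hat x=(\partial_s^k\hat x_i)_{0\le k\le i}$ (all derivatives, $n_S+n_{\hat x}$ components), $\mathcal C\hat x=(\partial_s^k\hat x_i)_{0\le k<i}$ (the absolutely continuous ones, $n_S$ components), $\mathcal B\hat x=\begin{bmatrix}(\mathcal C\hat x)(a)\\(\mathcal C\hat x)(b)\end{bmatrix}$ and $\mathcal D\hat x=(\partial_s^i\hat x_i)_{0\le i\le N}$. Let $\mathbb RL_2^{m,p}=\mathbb R^m\times L_2^p[a,b]$ with the sum of the two inner products. A *4-PI operator* is an operator $\mathbb RL_2^{m,q}\to\mathbb RL_2^{k,p}$ of the form $$\begin{bmatrix}P&Q_1\\Q_2&\{R_0,R_1,R_2\}\end{bmatrix}\begin{bmatrix}u\\ f\end{bmatrix}=\begin{bmatrix}Pu+\int_a^bQ_1(\theta)f(\theta)\,d\theta\\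 Q_2(s)u+R_0(s)f(s)+\int_a^sR_1(s,\theta)f(\theta)\,d\theta+\int_s^bR_2(s,\theta)f(\theta)\,d\theta\end{bmatrix}$$ with $P$ a matrix, $Q_1,Q_2,R_0$ essentially bounded and $R_1,R_2$ separable, i.e. $R_j(s,\theta)=F_j(s)^{T}G_j(\theta)$ with $F_j,G_j$ essentially bounded. The same notation is used for the operators below, whose parameters may also be square-integrable (all but $R_0$, which is essentially bounded). **The GPDE.** The data are real matrices $A,B_{xw},B_{xu},B_{xr},C_z,D_{zw},D_{zu},D_{zr},C_y,D_{yw},D_{yu},D_{yr},C_v,D_{vw},D_{vu}$ (the ODE), $B,B_v$ and a square-integrable $B_I$ (the boundary conditions), and $A_0$ (essentially bounded), $A_1,A_2$ (square-integrable on $[a,b]^2$), $B_{xv},B_{xb},C_r$ (square-integrable) and a matrix $D_{rb}$ (the in-domain dynamics), all of compatible sizes. Let $$X_v=\Big\{\hat x\in W^n:\int_a^bB_I(s)(\mathcal F\hat x)(s)\,ds+B_vv-B\,\mathcal B\hat x=0\Big\},$$ $$\mathcal X_{w,u}=\{(x,\hat x)\in\mathbb R^{n_x}\times W^n:\hat x\in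 X_{v},\ v=C_vx+D_{vw}w+D_{vu}u\}.$$ Let $(x^0,\hat x^0)\in\mathcal X_{w(0),u(0)}$ and $w,u\in L_{2e}[\mathbb R_+]$ with $B_vD_{vw}w,\ B_vD_{vu}u\in W_{1e}[\mathbb R_+]$, where the subscript $e$ means: on every $[0,T]$. A tuple $(x,\hat x,z,y,v,r)$ *satisfies the GPDE with initial condition $(x^0,\hat x^0)$ and input $(w,u)$* if $z,y,v,r\in L_{2e}[\mathbb R_+]$; $(x(t),\hat x(t))\in\mathcal X_{w(t),u(t)}$ for all $t\ge0$; $x$ (in $\mathbb R^{n_x}$) and $t\mapsto\hat x(t)$ (in $L_2^{n_{\hat x}}[a,b]$) are absolutely continuous on every $[0,T]$ and differentiable at almost every $t\ge0$; $x(0)=x^0$, $\hat x(0)=\hat x^0$; and for almost all $t\ge0$ $$\dot x=Ax+B_{xw}w+B_{xu}u+B_{xr}r,\quad z=C_zx+D_{zw}w+D_{zu}u+D_{zr}r,\quad y=C_yx+D_{yw}w+D_{yu}u+D_{yr}r,\quad v=C_vx+D_{vw}w+D_{vu}u,$$ $$\dot{\hat x}(t,s)=A_0(s)(\mathcal F\hat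 x(t))(s)+\int_a^sA_1(s,\theta)(\mathcal F\hat x(t))(\theta)\,d\theta+\int_s^bA_2(s,\theta)(\mathcal F\hat x(t))(\theta)\,d\theta+B_{xv}(s)v(t)+B_{xb}(s)\mathcal B\hat x(t)\quad\text{for almost every }s\in[a,b],$$ $$r(t)=\int_a^bC_r(\theta)(\mathcal F\hat x(t))(\theta)\,d\theta+D_{rb}\,\mathcal B\hat x(t).$$ **The PIE.** Let $T(s)$ ($n_S\times n_S$), $Q(s)$ ($n_S\times n_{\hat x}$) and the $0$-$1$ matrices $U_1,U_2$ be given by Taylor's formula and by the splitting of $\mathcal F$: for all $f\in W^n$, $(\mathcal Cf)(s)=T(s-a)(\mathcal Cf)(a)+\int_a^sQ(s-\theta)(\mathcal Df)(\theta)\,d\theta$ and $\mathcal Ff=U_1\mathcal Df+U_2\mathcal Cf$; the entries of $T(s)$ and $Q(s)$ are $0$ or $s^k/k!$. Put $$B_T=B\begin{bmatrix}T(0)\\T(b-a)\end{bmatrix}-\int_a^bB_I(s)U_2T(s-a)\,ds .$$ The pair $\{n,(B,B_I,B_v)\}$ is *admissible* if $B_T$ is (square and) invertible. In that case let $$B_Q(s)=B_T^{-1}\Big(B_I(s)U_1+\int_s^bB_I(\theta)U_2Q(\theta-s)\,d\theta-B\begin{bmatrix}0\\Q(b-s)\end{bmatrix}\Big),$$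 let $E$ be the $n_{\hat x}\times n_S$ matrix that keeps the components with $k=0$ of $\mathcal C$ (zero rows for $i=0$), let $\hat{\mathcal T}$ be the operator $\{R_0,R_1,R_2\}$ with $R_0=\mathrm{diag}(I_{n_0},0)$, $R_2(s,\theta)=ET(s-a)B_Q(\theta)$, $R_1(s,\theta)=EQ(s-\theta)+R_2(s,\theta)$, let $\mathcal T_v$ be multiplication by $ET(s-a)B_T^{-1}B_v$, and let $$\Upsilon=\left[\begin{array}{c|c}\begin{bmatrix}I\\B_T^{-1}B_v\\T(b-a)B_T^{-1}B_v\end{bmatrix}&\begin{bmatrix}0\\B_Q(s)\\T(b-a)B_Q(s)+Q(b-s)\end{bmatrix}\\ \hline U_2T(s-a)B_T^{-1}B_v&\{U_1,\ R_{D,2}+U_2Q(s-\theta),\ R_{D,2}\}\end{array}\right],\qquad R_{D,2}(s,\theta)=U_2T(s-a)B_Q(\theta),$$ $$\Xi=\left[\begin{array}{c|c}\begin{bmatrix}0&D_{rb}\end{bmatrix}&C_r\\ \hline\begin{bmatrix}B_{xv}&B_{xb}\end{bmatrix}&\{A_0,A_1,A_2\}\end{array}\right],\qquad\begin{bmatrix}\mathcal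 D_{rv}&\mathcal C_r\\\mathcal B_v&\hat{\mathcal A}\end{bmatrix}=\Xi\,\Upsilon .$$ The operators of the associated PIE with zero input, $\mathcal T\dot{\underline{\mathbf x}}=\mathcal A\underline{\mathbf x}$ on $\mathbb RL_2^{n_x,n_{\hat x}}$, are $$\mathcal T=\begin{bmatrix}I&0\\\mathcal T_vC_v&\hat{\mathcal T}\end{bmatrix},\qquad\mathcal A=\begin{bmatrix}A+B_{xr}\mathcal D_{rv}C_v&B_{xr}\mathcal C_r\\\mathcal B_vC_v&\hat{\mathcal A}\end{bmatrix}.$$ **Theorem.** Suppose that $\{n,(B,B_I,B_v)\}$ is admissible and that there are $\epsilon,\delta>0$ and a 4-PI operator $\mathcal P$ on $\mathbb RL_2^{n_x,n_{\hat x}}$ with $\mathcal P=\mathcal P^*\ge\epsilon I$ and $$\mathcal A^*\mathcal P\mathcal T+\mathcal T^*\mathcal P\mathcal A\le-\delta\,\mathcal T^*\mathcal T .$$ Then the GPDE is exponentially stable in the $\mathbb RL_2^{n_x,n_{\hat x}}$ norm: there are $M,\alpha>0$ such that for every $(x^0,\hat x^0)\in\mathcal X_{0,0}$, every $(x,\hat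 x,z,y,v,r)$ that satisfies the GPDE with initial condition $(x^0,\hat x^0)$ and input $(0,0)$ satisfies $$\left\|\begin{bmatrix}x(t)\\\hat x(t)\end{bmatrix}\right\|_{\mathbb RL_2}\le M\left\|\begin{bmatrix}x^0\\\hat x^0\end{bmatrix}\right\|_{\mathbb RL_2}e^{-\alpha t}\qquad\text{for all }t\ge0 .$$ -/

import Mathlib

open MeasureTheory
open scoped ENNReal Matrix

namespace GPDE

noncomputable section

/-- Lebesgue measure on the interval `[a, b]`. -/
abbrev mu (a b : ℝ) : Measure ℝ := volume.restrict (Set.Icc a b)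

/-- Euclidean space with coordinates indexed by `ι`. -/
abbrev Vec (ι : Type) : Type := EuclideanSpace ℝ ι

/-- The Hilbert space `L₂[a, b]` of vector-valued square-integrable functions. -/
abbrev L2 (a b : ℝ) (ι : Type) [Fintype ι] : Type := Lp (Vec ι) 2 (mu a b)

/-- The Hilbert space `ℝᵐ × L₂ⁿ[a, b]` with the sum of the two inner products. -/
abbrev RL2 (a b : ℝ) (m n : Type) [Fintype m] [Fintype n] : Type := WithLp 2 (Vec m × L2 a b n)

/-- Matrix-vector multiplication on Euclidean spaces. -/
def mv {m n : Type} [Fintype n] (M : Matrix m n ℝ) (x : Vec n) : Vec m :=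
  WithLp.toLp 2 (M *ᵥ x.ofLp)

/-- All entries of a matrix-valued function belong to `Lᵖ`. -/
def MatMemLp {X m n : Type} [MeasurableSpace X] (F : X → Matrix m n ℝ) (p : ℝ≥0∞)
    (μ : Measure X) : Prop :=
  ∀ i j, MemLp (fun x => F x i j) p μ

section Aux

set_option linter.unusedSectionVars false

variable {m n : Type} [Fintype m] [Fintype n]

theorem mv_apply (M : Matrix m n ℝ) (x : Vec n) (i : m) : mv M x i = ∑ j, M i j * x j := rfl

theorem mv_add (M : Matrix m n ℝ) (x y : Vec n) : mv M (x + y) = mv M x + mv M y := by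
  simp [mv, Matrix.mulVec_add]

theorem mv_smul (M : Matrix m n ℝ) (c : ℝ) (x : Vec n) : mv M (c • x) = c • mv M x := by
  simp [mv, Matrix.mulVec_smul]

theorem add_mv (M M' : Matrix m n ℝ) (x : Vec n) : mv (M + M') x = mv M x + mv M' x := by
  simp [mv, Matrix.add_mulVec]

/-- The sum of the absolute values of the entries. -/
def absSum (M : Matrix m n ℝ) : ℝ := ∑ i, ∑ j, |M i j|

theorem absSum_nonneg (M : Matrix m n ℝ) : 0 ≤ absSum M :=
  Finset.sum_nonneg fun _ _ => Finset.sum_nonneg fun _ _ => abs_nonneg _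

theorem norm_mv_le (M : Matrix m n ℝ) (x : Vec n) : ‖mv M x‖ ≤ absSum M * ‖x‖ := by
  classical
  have h : mv M x = ∑ i, (∑ j, M i j * x j) • EuclideanSpace.single i (1 : ℝ) := by
    ext i
    simp [mv_apply, Finset.sum_apply, Pi.single_apply]
  rw [h, absSum, Finset.sum_mul]
  refine (norm_sum_le _ _).trans (Finset.sum_le_sum fun i _ => ?_)
  rw [norm_smul, PiLp.norm_single, norm_one, mul_one, Finset.sum_mul]
  refine (norm_sum_le _ _).trans (Finset.sum_le_sum fun j _ => ?_)
  rw [norm_mul, Real.norm_eq_abs]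
  exact mul_le_mul_of_nonneg_left (PiLp.norm_apply_le x j) (abs_nonneg _)

theorem MatMemLp.absSum {X : Type} [MeasurableSpace X] {F : X → Matrix m n ℝ} {p : ℝ≥0∞}
    {μ : Measure X} (h : MatMemLp F p μ) : MemLp (fun x => absSum (F x)) p μ :=
  memLp_finsetSum _ fun i _ => memLp_finsetSum _ fun j _ => (h i j).abs

theorem aesm_mv {X : Type} [MeasurableSpace X] {F : X → Matrix m n ℝ} {p : ℝ≥0∞}
    {μ : Measure X} (h : MatMemLp F p μ) {v : X → Vec n} (hv : AEStronglyMeasurable v μ) :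
    AEStronglyMeasurable (fun x => mv (F x) (v x)) μ := by
  classical
  have e : (fun x => mv (F x) (v x)) =
      fun x => ∑ i, (∑ j, F x i j * v x j) • EuclideanSpace.single i (1 : ℝ) := by
    funext x
    ext i
    simp [mv_apply, Finset.sum_apply, Pi.single_apply]
  rw [e]
  refine Finset.aestronglyMeasurable_fun_sum _ fun i _ => ?_
  refine AEStronglyMeasurable.smul_const ?_ _
  refine Finset.aestronglyMeasurable_fun_sum _ fun j _ => ?_
  exact (h i j).1.mul ((EuclideanSpace.proj (𝕜 := ℝ) j).continuous.comp_aestronglyMeasurable hv)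

end Aux

section Operators

set_option linter.unusedSectionVars false

variable {a b : ℝ} {m n : Type} [Fintype m] [Fintype n]

/-- A matrix as a bounded operator between Euclidean spaces. -/
def matOp (M : Matrix m n ℝ) : Vec n →L[ℝ] Vec m :=
  LinearMap.toContinuousLinearMap
    { toFun := mv M
      map_add' := mv_add M
      map_smul' := mv_smul M }

theorem memLp_mv_const {Q : ℝ → Matrix m n ℝ} (hQ : MatMemLp Q 2 (mu a b)) (u : Vec n) :
    MemLp (fun s => mv (Q s) u) 2 (mu a b) :=
  MemLp.of_eval_piLp fun i =>
    (memLp_finsetSum Finset.univ fun j _ => (hQ i j).mul_const (u j) : _)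

/-- The operator `u ↦ (s ↦ Q(s) u)` from `ℝⁿ` to `L₂`. -/
def funcOp (Q : ℝ → Matrix m n ℝ) (hQ : MatMemLp Q 2 (mu a b)) : Vec n →L[ℝ] L2 a b m :=
  LinearMap.toContinuousLinearMap
    { toFun := fun u => (memLp_mv_const hQ u).toLp (fun s => mv (Q s) u)
      map_add' := fun u u' => by
        rw [← MemLp.toLp_add]
        exact MemLp.toLp_congr _ _ (.of_forall fun s => mv_add _ _ _)
      map_smul' := fun c u => by
        rw [RingHom.id_apply, ← MemLp.toLp_const_smul]
        exact MemLp.toLp_congr _ _ (.of_forall fun s => mv_smul _ _ _) }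

theorem integrable_mv {X : Type} [MeasurableSpace X] {μ : Measure X} {Q : X → Matrix m n ℝ}
    (hQ : MatMemLp Q 2 μ) {v : X → Vec n} (hv : MemLp v 2 μ) :
    Integrable (fun s => mv (Q s) (v s)) μ := by
  have h : Integrable (fun s => absSum (Q s) * ‖v s‖) μ := hQ.absSum.integrable_mul hv.norm
  refine h.mono' (aesm_mv hQ hv.1) (.of_forall fun s => norm_mv_le _ _)

theorem enorm_integral_mv_le {X : Type} [MeasurableSpace X] {μ : Measure X} {Q : X → Matrix m n ℝ}
    (hQ : AEStronglyMeasurable (fun x => absSum (Q x)) μ) {v : X → Vec n}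
    (hv : AEStronglyMeasurable v μ) :
    ‖∫ θ, mv (Q θ) (v θ) ∂μ‖ₑ ≤ eLpNorm (fun x => absSum (Q x)) 2 μ * eLpNorm v 2 μ := by
  refine (enorm_integral_le_lintegral_enorm _).trans ?_
  rw [← eLpNorm_one_eq_lintegral_enorm]
  refine le_trans (eLpNorm_mono (g := (fun x => absSum (Q x)) • v) fun x => ?_)
    (eLpNorm_smul_le_mul_eLpNorm hv hQ)
  rw [Pi.smul_apply', norm_smul, Real.norm_of_nonneg (absSum_nonneg _)]
  exact norm_mv_le _ _

/-- The operator `v ↦ ∫ₐᵇ Q(θ) v(θ) dθ` from `L₂` to `ℝᵐ`. -/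
def integralOp (Q : ℝ → Matrix m n ℝ) (hQ : MatMemLp Q 2 (mu a b)) : L2 a b n →L[ℝ] Vec m :=
  LinearMap.mkContinuousOfExistsBound
    { toFun := fun v => ∫ θ, mv (Q θ) (v θ) ∂(mu a b)
      map_add' := fun v w => by
        rw [← integral_add (integrable_mv hQ (Lp.memLp v)) (integrable_mv hQ (Lp.memLp w))]
        refine integral_congr_ae ?_
        filter_upwards [Lp.coeFn_add v w] with s hs
        rw [hs, Pi.add_apply, mv_add]
      map_smul' := fun c v => by
        rw [RingHom.id_apply, ← integral_smul]
        refine integral_congr_ae ?_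
        filter_upwards [Lp.coeFn_smul c v] with s hs
        rw [hs, Pi.smul_apply, mv_smul] }
    (by
      refine ⟨(eLpNorm (fun s => absSum (Q s)) 2 (mu a b)).toReal, fun v => ?_⟩
      rw [Lp.norm_def, ← ENNReal.toReal_mul, ← toReal_enorm]
      exact ENNReal.toReal_mono (ENNReal.mul_ne_top hQ.absSum.2.ne (Lp.memLp v).2.ne)
        (enorm_integral_mv_le hQ.absSum.1 (Lp.aestronglyMeasurable v)))

theorem memLp_mul {R : ℝ → Matrix m n ℝ} (hR : MatMemLp R ∞ (mu a b)) (v : L2 a b n) :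
    MemLp (fun s => mv (R s) (v s)) 2 (mu a b) :=
  MemLp.of_eval_piLp fun i =>
    (memLp_finsetSum Finset.univ fun j _ => ((Lp.memLp v).eval_piLp j).mul' (hR i j) : _)

/-- The multiplication operator `(R v)(s) = R(s) v(s)` from `L₂` to `L₂`. -/
def multOp (R : ℝ → Matrix m n ℝ) (hR : MatMemLp R ∞ (mu a b)) : L2 a b n →L[ℝ] L2 a b m :=
  LinearMap.mkContinuousOfExistsBound
    { toFun := fun v => (memLp_mul hR v).toLp (fun s => mv (R s) (v s))
      map_add' := fun v w => by
        rw [← MemLp.toLp_add]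
        refine MemLp.toLp_congr _ _ ?_
        filter_upwards [Lp.coeFn_add v w] with s hs
        rw [hs, Pi.add_apply, mv_add]
        rfl
      map_smul' := fun c v => by
        rw [RingHom.id_apply, ← MemLp.toLp_const_smul]
        refine MemLp.toLp_congr _ _ ?_
        filter_upwards [Lp.coeFn_smul c v] with s hs
        rw [hs, Pi.smul_apply, mv_smul]
        rfl }
    (by
      refine ⟨(eLpNorm (fun s => absSum (R s)) ∞ (mu a b)).toReal, fun v => ?_⟩
      refine Lp.norm_le_mul_norm_of_ae_le_mul ?_
      have hfin : eLpNormEssSup (fun s => absSum (R s)) (mu a b) ≠ ∞ := by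
        simpa using hR.absSum.2.ne
      filter_upwards [(memLp_mul hR v).coeFn_toLp,
        ae_le_eLpNormEssSup (f := fun s => absSum (R s)) (μ := mu a b)] with s hs hs'
      refine (le_of_eq (congrArg norm hs)).trans ((norm_mv_le _ _).trans ?_)
      refine mul_le_mul_of_nonneg_right ?_ (norm_nonneg _)
      have := ENNReal.toReal_mono hfin hs'
      rwa [toReal_enorm, Real.norm_of_nonneg (absSum_nonneg _)] at this)

theorem aesm_kernel {K : ℝ → ℝ → Matrix m n ℝ}
    (hK : MatMemLp (fun z : ℝ × ℝ => K z.1 z.2) 2 ((mu a b).prod (mu a b))) (v : L2 a b n) :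
    AEStronglyMeasurable (fun s => ∫ θ, mv (K s θ) (v θ) ∂(mu a b)) (mu a b) :=
  (aesm_mv hK (Lp.aestronglyMeasurable v).comp_snd).integral_prod_right'

theorem eLpNorm_kernel_le {K : ℝ → ℝ → Matrix m n ℝ}
    (hK : MatMemLp (fun z : ℝ × ℝ => K z.1 z.2) 2 ((mu a b).prod (mu a b))) (v : L2 a b n) :
    eLpNorm (fun s => ∫ θ, mv (K s θ) (v θ) ∂(mu a b)) 2 (mu a b) ≤
      eLpNorm (fun z : ℝ × ℝ => absSum (K z.1 z.2)) 2 ((mu a b).prod (mu a b)) *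
        eLpNorm v 2 (mu a b) := by
  have key : ∀ {X : Type} [MeasurableSpace X] {ν : Measure X} {E : Type} [NormedAddCommGroup E]
      (f : X → E), eLpNorm f 2 ν ^ (2 : ℝ) = ∫⁻ x, ‖f x‖ₑ ^ (2 : ℝ) ∂ν := by
    intro X _ ν E _ f
    simpa using eLpNorm_nnreal_pow_eq_lintegral (f := f) (μ := ν) (p := 2) two_ne_zero
  rw [← ENNReal.rpow_le_rpow_iff (z := 2) two_pos, ENNReal.mul_rpow_of_nonneg _ _ two_pos.le,
    key, key, lintegral_prod _ (hK.absSum.1.enorm.pow_const _)]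
  have hfin : eLpNorm v 2 (mu a b) ^ (2 : ℝ) ≠ ∞ :=
    ENNReal.rpow_ne_top_of_nonneg two_pos.le (Lp.memLp v).2.ne
  rw [← lintegral_mul_const' _ _ hfin]
  refine lintegral_mono_ae ?_
  filter_upwards [hK.absSum.1.prodMk_left] with s hs
  rw [← key (fun θ => absSum (K s θ)), ← ENNReal.mul_rpow_of_nonneg _ _ two_pos.le]
  exact ENNReal.rpow_le_rpow (enorm_integral_mv_le hs (Lp.aestronglyMeasurable v)) two_pos.le

theorem memLp_kernel {K : ℝ → ℝ → Matrix m n ℝ}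
    (hK : MatMemLp (fun z : ℝ × ℝ => K z.1 z.2) 2 ((mu a b).prod (mu a b))) (v : L2 a b n) :
    MemLp (fun s => ∫ θ, mv (K s θ) (v θ) ∂(mu a b)) 2 (mu a b) :=
  ⟨aesm_kernel hK v, (eLpNorm_kernel_le hK v).trans_lt
    (ENNReal.mul_lt_top hK.absSum.2 (Lp.memLp v).2)⟩

theorem ae_memLp_kernel {K : ℝ → ℝ → Matrix m n ℝ}
    (hK : MatMemLp (fun z : ℝ × ℝ => K z.1 z.2) 2 ((mu a b).prod (mu a b))) :
    ∀ᵐ s ∂(mu a b), MatMemLp (K s) 2 (mu a b) := by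
  have h : ∀ i j, ∀ᵐ s ∂(mu a b), MemLp (fun θ => K s θ i j) 2 (mu a b) := fun i j => by
    filter_upwards [(hK i j).1.prodMk_left, (hK i j).integrable_sq.prod_right_ae] with s h1 h2
    exact (memLp_two_iff_integrable_sq h1).2 h2
  have h' := ae_all_iff.2 fun i => ae_all_iff.2 fun j => h i j
  filter_upwards [h'] with s hs i j using hs i j

/-- The integral operator `(K v)(s) = ∫ₐᵇ K(s, θ) v(θ) dθ` from `L₂` to `L₂` with a
square-integrable kernel. -/
def kernelOp (K : ℝ → ℝ → Matrix m n ℝ)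
    (hK : MatMemLp (fun z : ℝ × ℝ => K z.1 z.2) 2 ((mu a b).prod (mu a b))) :
    L2 a b n →L[ℝ] L2 a b m :=
  LinearMap.mkContinuousOfExistsBound
    { toFun := fun v => (memLp_kernel hK v).toLp (fun s => ∫ θ, mv (K s θ) (v θ) ∂(mu a b))
      map_add' := fun v w => by
        rw [← MemLp.toLp_add]
        refine MemLp.toLp_congr _ _ ?_
        filter_upwards [ae_memLp_kernel hK] with s hs
        refine Eq.trans ?_
          (integral_add (integrable_mv hs (Lp.memLp v)) (integrable_mv hs (Lp.memLp w)))
        refine integral_congr_ae ?_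
        filter_upwards [Lp.coeFn_add v w] with θ hθ
        rw [hθ, Pi.add_apply, mv_add]
      map_smul' := fun c v => by
        rw [RingHom.id_apply, ← MemLp.toLp_const_smul]
        refine MemLp.toLp_congr _ _ (.of_forall fun s => ?_)
        refine Eq.trans ?_ (integral_smul c _)
        refine integral_congr_ae ?_
        filter_upwards [Lp.coeFn_smul c v] with θ hθ
        rw [hθ, Pi.smul_apply, mv_smul] }
    (by
      refine ⟨(eLpNorm (fun z : ℝ × ℝ => absSum (K z.1 z.2)) 2 ((mu a b).prod (mu a b))).toReal,
        fun v => ?_⟩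
      rw [Lp.norm_def v, ← ENNReal.toReal_mul]
      refine (Lp.norm_toLp _ (memLp_kernel hK v)).trans_le ?_
      exact ENNReal.toReal_mono (ENNReal.mul_ne_top hK.absSum.2.ne (Lp.memLp v).2.ne)
        (eLpNorm_kernel_le hK v))

/-- The part of a kernel on `{θ ≤ s}`. -/
def lowerKer (R : ℝ → ℝ → Matrix m n ℝ) : ℝ → ℝ → Matrix m n ℝ :=
  fun s θ => if θ ≤ s then R s θ else 0

/-- The part of a kernel on `{s < θ}`. -/
def upperKer (R : ℝ → ℝ → Matrix m n ℝ) : ℝ → ℝ → Matrix m n ℝ :=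
  fun s θ => if s < θ then R s θ else 0

theorem MatMemLp.indicator {X : Type} [MeasurableSpace X] {μ : Measure X} {p : ℝ≥0∞}
    {F : X → Matrix m n ℝ} (h : MatMemLp F p μ) {P : X → Prop} [DecidablePred P]
    (hP : MeasurableSet {x | P x}) :
    MatMemLp (fun x => if P x then F x else 0) p μ := fun i j => by
  refine (memLp_congr_ae (.of_forall fun x => ?_)).1 ((h i j).indicator hP)
  by_cases hx : P x <;> simp [Set.indicator, hx]

theorem memLp_lowerKer {R : ℝ → ℝ → Matrix m n ℝ}
    (h : MatMemLp (fun z : ℝ × ℝ => R z.1 z.2) 2 ((mu a b).prod (mu a b))) :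
    MatMemLp (fun z : ℝ × ℝ => lowerKer R z.1 z.2) 2 ((mu a b).prod (mu a b)) :=
  MatMemLp.indicator (P := fun z : ℝ × ℝ => z.2 ≤ z.1) h
    (measurableSet_le measurable_snd measurable_fst)

theorem memLp_upperKer {R : ℝ → ℝ → Matrix m n ℝ}
    (h : MatMemLp (fun z : ℝ × ℝ => R z.1 z.2) 2 ((mu a b).prod (mu a b))) :
    MatMemLp (fun z : ℝ × ℝ => upperKer R z.1 z.2) 2 ((mu a b).prod (mu a b)) :=
  MatMemLp.indicator (P := fun z : ℝ × ℝ => z.1 < z.2) h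
    (measurableSet_lt measurable_fst measurable_snd)

/-- The 3-PI operator
`v ↦ (s ↦ R₀(s) v(s) + ∫ₐˢ R₁(s, θ) v(θ) dθ + ∫ₛᵇ R₂(s, θ) v(θ) dθ)` from `L₂` to `L₂`. -/
def threePI (R0 : ℝ → Matrix m n ℝ) (R1 R2 : ℝ → ℝ → Matrix m n ℝ)
    (h0 : MatMemLp R0 ∞ (mu a b))
    (h1 : MatMemLp (fun z : ℝ × ℝ => R1 z.1 z.2) 2 ((mu a b).prod (mu a b)))
    (h2 : MatMemLp (fun z : ℝ × ℝ => R2 z.1 z.2) 2 ((mu a b).prod (mu a b))) :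
    L2 a b n →L[ℝ] L2 a b m :=
  multOp R0 h0 + kernelOp (lowerKer R1) (memLp_lowerKer h1)
    + kernelOp (upperKer R2) (memLp_upperKer h2)

theorem zero_mv (x : Vec n) : mv (0 : Matrix m n ℝ) x = 0 := by
  simp [mv]

/-- The defining formula of a 3-PI operator. -/
theorem threePI_coe (R0 : ℝ → Matrix m n ℝ) (R1 R2 : ℝ → ℝ → Matrix m n ℝ)
    (h0 : MatMemLp R0 ∞ (mu a b))
    (h1 : MatMemLp (fun z : ℝ × ℝ => R1 z.1 z.2) 2 ((mu a b).prod (mu a b)))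
    (h2 : MatMemLp (fun z : ℝ × ℝ => R2 z.1 z.2) 2 ((mu a b).prod (mu a b))) (v : L2 a b n) :
    ∀ᵐ s ∂(mu a b), threePI R0 R1 R2 h0 h1 h2 v s =
      mv (R0 s) (v s) + (∫ θ in a..s, mv (R1 s θ) (v θ)) + ∫ θ in s..b, mv (R2 s θ) (v θ) := by
  have e1 : ∀ᵐ s ∂(mu a b), multOp R0 h0 v s = mv (R0 s) (v s) := (memLp_mul h0 v).coeFn_toLp
  have e2 : ∀ᵐ s ∂(mu a b), kernelOp (lowerKer R1) (memLp_lowerKer h1) v s =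
      ∫ θ, mv (lowerKer R1 s θ) (v θ) ∂(mu a b) :=
    (memLp_kernel (memLp_lowerKer h1) v).coeFn_toLp
  have e3 : ∀ᵐ s ∂(mu a b), kernelOp (upperKer R2) (memLp_upperKer h2) v s =
      ∫ θ, mv (upperKer R2 s θ) (v θ) ∂(mu a b) :=
    (memLp_kernel (memLp_upperKer h2) v).coeFn_toLp
  filter_upwards [e1, e2, e3, ae_restrict_mem measurableSet_Icc,
    Lp.coeFn_add (multOp R0 h0 v + kernelOp (lowerKer R1) (memLp_lowerKer h1) v)
      (kernelOp (upperKer R2) (memLp_upperKer h2) v),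
    Lp.coeFn_add (multOp R0 h0 v) (kernelOp (lowerKer R1) (memLp_lowerKer h1) v)]
    with s e1 e2 e3 hs e4 e5
  have e6 : threePI R0 R1 R2 h0 h1 h2 v s = multOp R0 h0 v s
      + kernelOp (lowerKer R1) (memLp_lowerKer h1) v s
      + kernelOp (upperKer R2) (memLp_upperKer h2) v s := by
    refine Eq.trans e4 ?_
    rw [Pi.add_apply, e5, Pi.add_apply]
  rw [e6, e1, e2, e3]
  congr 1
  · congr 1
    have : (fun θ => mv (lowerKer R1 s θ) (v θ)) =
        (Set.Iic s).indicator fun θ => mv (R1 s θ) (v θ) := by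
      funext θ
      by_cases h : θ ≤ s <;> simp [lowerKer, Set.indicator, h, zero_mv]
    rw [this, integral_indicator measurableSet_Iic, Measure.restrict_restrict measurableSet_Iic,
      intervalIntegral.integral_of_le hs.1, ← integral_Icc_eq_integral_Ioc]
    congr 2
    ext θ
    simp only [Set.mem_inter_iff, Set.mem_Iic, Set.mem_Icc]
    constructor
    · rintro ⟨h, h', -⟩
      exact ⟨h', h⟩
    · rintro ⟨h, h'⟩
      exact ⟨h', h, h'.trans hs.2⟩
  · have : (fun θ => mv (upperKer R2 s θ) (v θ)) =
        (Set.Ioi s).indicator fun θ => mv (R2 s θ) (v θ) := by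
      funext θ
      by_cases h : s < θ <;> simp [upperKer, Set.indicator, h, zero_mv]
    rw [this, integral_indicator measurableSet_Ioi, Measure.restrict_restrict measurableSet_Ioi,
      intervalIntegral.integral_of_le hs.2]
    congr 2
    ext θ
    simp only [Set.mem_inter_iff, Set.mem_Ioi, Set.mem_Icc, Set.mem_Ioc]
    constructor
    · rintro ⟨h, -, h'⟩
      exact ⟨h, h'⟩
    · rintro ⟨h, h'⟩
      exact ⟨h, hs.1.trans h.le, h'⟩

/-- The block operator `[[T₁₁, T₁₂], [T₂₁, T₂₂]]` on products with the `ℓ²` norm. -/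
def blockOp {E F E' F' : Type} [NormedAddCommGroup E] [NormedSpace ℝ E] [NormedAddCommGroup F]
    [NormedSpace ℝ F] [NormedAddCommGroup E'] [NormedSpace ℝ E'] [NormedAddCommGroup F']
    [NormedSpace ℝ F'] (T11 : E →L[ℝ] E') (T12 : F →L[ℝ] E') (T21 : E →L[ℝ] F')
    (T22 : F →L[ℝ] F') : WithLp 2 (E × F) →L[ℝ] WithLp 2 (E' × F') :=
  (WithLp.prodContinuousLinearEquiv 2 ℝ E' F').symm.toContinuousLinearMap.comp
    (((T11.coprod T12).prod (T21.coprod T22)).comp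
      (WithLp.prodContinuousLinearEquiv 2 ℝ E F).toContinuousLinearMap)

/-- The `(1,1)` block of an operator between products. -/
def block11 {E F E' F' : Type} [NormedAddCommGroup E] [NormedSpace ℝ E] [NormedAddCommGroup F]
    [NormedSpace ℝ F] [NormedAddCommGroup E'] [NormedSpace ℝ E'] [NormedAddCommGroup F']
    [NormedSpace ℝ F'] (T : WithLp 2 (E × F) →L[ℝ] WithLp 2 (E' × F')) : E →L[ℝ] E' :=
  (WithLp.fstL 2 ℝ E' F').comp (T.comp
    ((WithLp.prodContinuousLinearEquiv 2 ℝ E F).symm.toContinuousLinearMap.comp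
      (ContinuousLinearMap.inl ℝ E F)))

/-- The `(1,2)` block of an operator between products. -/
def block12 {E F E' F' : Type} [NormedAddCommGroup E] [NormedSpace ℝ E] [NormedAddCommGroup F]
    [NormedSpace ℝ F] [NormedAddCommGroup E'] [NormedSpace ℝ E'] [NormedAddCommGroup F']
    [NormedSpace ℝ F'] (T : WithLp 2 (E × F) →L[ℝ] WithLp 2 (E' × F')) : F →L[ℝ] E' :=
  (WithLp.fstL 2 ℝ E' F').comp (T.comp
    ((WithLp.prodContinuousLinearEquiv 2 ℝ E F).symm.toContinuousLinearMap.comp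
      (ContinuousLinearMap.inr ℝ E F)))

/-- The `(2,1)` block of an operator between products. -/
def block21 {E F E' F' : Type} [NormedAddCommGroup E] [NormedSpace ℝ E] [NormedAddCommGroup F]
    [NormedSpace ℝ F] [NormedAddCommGroup E'] [NormedSpace ℝ E'] [NormedAddCommGroup F']
    [NormedSpace ℝ F'] (T : WithLp 2 (E × F) →L[ℝ] WithLp 2 (E' × F')) : E →L[ℝ] F' :=
  (WithLp.sndL 2 ℝ E' F').comp (T.comp
    ((WithLp.prodContinuousLinearEquiv 2 ℝ E F).symm.toContinuousLinearMap.comp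
      (ContinuousLinearMap.inl ℝ E F)))

/-- The `(2,2)` block of an operator between products. -/
def block22 {E F E' F' : Type} [NormedAddCommGroup E] [NormedSpace ℝ E] [NormedAddCommGroup F]
    [NormedSpace ℝ F] [NormedAddCommGroup E'] [NormedSpace ℝ E'] [NormedAddCommGroup F']
    [NormedSpace ℝ F'] (T : WithLp 2 (E × F) →L[ℝ] WithLp 2 (E' × F')) : F →L[ℝ] F' :=
  (WithLp.sndL 2 ℝ E' F').comp (T.comp
    ((WithLp.prodContinuousLinearEquiv 2 ℝ E F).symm.toContinuousLinearMap.comp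
      (ContinuousLinearMap.inr ℝ E F)))

end Operators

/-- Parameters `[P, Q₁; Q₂, {R₀, R₁, R₂}]` of a 4-PI operator from `ℝⁿ × L₂^q` to `ℝᵐ × L₂^p`,
with the integrability that makes the operator bounded. -/
structure FourPIParams (a b : ℝ) (m p n q : Type) [Fintype m] [Fintype p] [Fintype n]
    [Fintype q] where
  P : Matrix m n ℝ
  Q1 : ℝ → Matrix m q ℝ
  Q2 : ℝ → Matrix p n ℝ
  R0 : ℝ → Matrix p q ℝ
  R1 : ℝ → ℝ → Matrix p q ℝ
  R2 : ℝ → ℝ → Matrix p q ℝ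
  memLp_Q1 : MatMemLp Q1 2 (mu a b)
  memLp_Q2 : MatMemLp Q2 2 (mu a b)
  memLp_R0 : MatMemLp R0 ∞ (mu a b)
  memLp_R1 : MatMemLp (fun z : ℝ × ℝ => R1 z.1 z.2) 2 ((mu a b).prod (mu a b))
  memLp_R2 : MatMemLp (fun z : ℝ × ℝ => R2 z.1 z.2) 2 ((mu a b).prod (mu a b))

/-- The operator
`(u, v) ↦ (P u + ∫ₐᵇ Q₁ v, s ↦ Q₂(s) u + R₀(s) v(s) + ∫ₐˢ R₁(s, θ) v(θ) dθ + ∫ₛᵇ R₂(s, θ) v(θ) dθ)`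
with the given parameters. -/
def FourPIParams.op {a b : ℝ} {m p n q : Type} [Fintype m] [Fintype p] [Fintype n]
    [Fintype q] (S : FourPIParams a b m p n q) : RL2 a b n q →L[ℝ] RL2 a b m p :=
  blockOp (matOp S.P) (integralOp S.Q1 S.memLp_Q1) (funcOp S.Q2 S.memLp_Q2)
    (threePI S.R0 S.R1 S.R2 S.memLp_R0 S.memLp_R1 S.memLp_R2)

/-- A kernel on `[a, b]²` is separable: `R(s, θ) = F(s)ᵀ G(θ)` with `F`, `G` essentially bounded. -/
def Separable (a b : ℝ) {p q : Type} (R : ℝ → ℝ → Matrix p q ℝ) : Prop :=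
  ∃ (r : ℕ) (F : ℝ → Matrix (Fin r) p ℝ) (G : ℝ → Matrix (Fin r) q ℝ),
    MatMemLp F ∞ (mu a b) ∧ MatMemLp G ∞ (mu a b) ∧
      ∀ s ∈ Set.Icc a b, ∀ θ ∈ Set.Icc a b, R s θ = (F s)ᵀ * G θ

/-- The operator is 4-PI: it is given by parameters `[P, Q₁; Q₂, {R₀, R₁, R₂}]` with `Q₁, Q₂, R₀`
essentially bounded and `R₁, R₂` separable. -/
def IsFourPI {a b : ℝ} {m p n q : Type} [Fintype m] [Fintype p] [Fintype n] [Fintype q]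
    (T : RL2 a b n q →L[ℝ] RL2 a b m p) : Prop :=
  ∃ S : FourPIParams a b m p n q, MatMemLp S.Q1 ∞ (mu a b) ∧ MatMemLp S.Q2 ∞ (mu a b) ∧
    Separable a b S.R1 ∧ Separable a b S.R2 ∧ T = S.op

section Closure

set_option linter.unusedSectionVars false

variable {X l m n : Type} [MeasurableSpace X] [Fintype l] [Fintype m] [Fintype n]
  {μ : Measure X}

theorem MatMemLp.add {p : ℝ≥0∞} {F G : X → Matrix m n ℝ} (hF : MatMemLp F p μ)
    (hG : MatMemLp G p μ) : MatMemLp (fun x => F x + G x) p μ :=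
  fun i j => (hF i j).add (hG i j)

theorem MatMemLp.sub {p : ℝ≥0∞} {F G : X → Matrix m n ℝ} (hF : MatMemLp F p μ)
    (hG : MatMemLp G p μ) : MatMemLp (fun x => F x - G x) p μ :=
  fun i j => (hF i j).sub (hG i j)

theorem MatMemLp.mul {p q r : ℝ≥0∞} [ENNReal.HolderTriple p q r] {F : X → Matrix l m ℝ}
    {G : X → Matrix m n ℝ} (hF : MatMemLp F p μ) (hG : MatMemLp G q μ) :
    MatMemLp (fun x => F x * G x) r μ := fun i j =>
  (memLp_finsetSum Finset.univ fun k _ => (hG k j).mul' (hF i k) : _)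

theorem MatMemLp.const [IsFiniteMeasure μ] (p : ℝ≥0∞) (M : Matrix m n ℝ) :
    MatMemLp (fun _ : X => M) p μ := fun _ _ => memLp_const _

theorem MatMemLp.fromRows {p : ℝ≥0∞} {F : X → Matrix l n ℝ} {G : X → Matrix m n ℝ}
    (hF : MatMemLp F p μ) (hG : MatMemLp G p μ) :
    MatMemLp (fun x => Matrix.fromRows (F x) (G x)) p μ := by
  rintro (i | i) j
  · exact hF i j
  · exact hG i j

theorem MatMemLp.fromCols {p : ℝ≥0∞} {F : X → Matrix n l ℝ} {G : X → Matrix n m ℝ}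
    (hF : MatMemLp F p μ) (hG : MatMemLp G p μ) :
    MatMemLp (fun x => Matrix.fromCols (F x) (G x)) p μ := by
  rintro i (j | j)
  · exact hF i j
  · exact hG i j

theorem matMemLp_of_continuous {a b : ℝ} (p : ℝ≥0∞) {F : ℝ → Matrix m n ℝ} (hF : Continuous F) :
    MatMemLp F p (mu a b) := fun i j => by
  have hc : Continuous fun x => F x i j := hF.matrix_elem i j
  obtain ⟨C, hC⟩ := isCompact_Icc.exists_bound_of_continuousOn (hc.continuousOn (s := Set.Icc a b))
  exact MemLp.of_bound hc.aestronglyMeasurable C ((ae_restrict_mem measurableSet_Icc).mono hC)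

theorem matMemLp_of_continuous₂ {a b : ℝ} (p : ℝ≥0∞) {F : ℝ × ℝ → Matrix m n ℝ}
    (hF : Continuous F) : MatMemLp F p ((mu a b).prod (mu a b)) := fun i j => by
  have hc : Continuous fun x => F x i j := hF.matrix_elem i j
  obtain ⟨C, hC⟩ := (isCompact_Icc.prod isCompact_Icc).exists_bound_of_continuousOn
    (hc.continuousOn (s := Set.Icc a b ×ˢ Set.Icc a b))
  refine MemLp.of_bound hc.aestronglyMeasurable C ?_
  rw [Measure.prod_restrict]
  exact (ae_restrict_mem (measurableSet_Icc.prod measurableSet_Icc)).mono hC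

theorem MatMemLp.comp_snd {a b : ℝ} {p : ℝ≥0∞} {F : ℝ → Matrix m n ℝ}
    (hF : MatMemLp F p (mu a b)) :
    MatMemLp (fun z : ℝ × ℝ => F z.2) p ((mu a b).prod (mu a b)) :=
  fun i j => (hF i j).comp_snd (mu a b)

end Closure

/-! ### The class of models -/

/-- `N + 1` groups of states; the `i`-th group has `n i` components, each `i` times
differentiable in space. -/
abbrev StateIdx {N : ℕ} (n : Fin (N + 1) → ℕ) : Type := Σ i : Fin (N + 1), Fin (n i)

/-- Indices `(p, k)` of the absolutely continuous functions `∂ₛᵏ x_p`, where `k < i` for a component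
`p` of the `i`-th group. There are `n_S` of them. -/
abbrev CIdx {N : ℕ} (n : Fin (N + 1) → ℕ) : Type := Σ p : StateIdx n, Fin p.1.val

/-- Indices `(p, k)` of all the partial derivatives `∂ₛᵏ x_p`, where `k ≤ i` for a component `p` of
the `i`-th group. There are `n_S + n_x` of them. -/
abbrev FIdx {N : ℕ} (n : Fin (N + 1) → ℕ) : Type := Σ p : StateIdx n, Fin (p.1.val + 1)

/-- Entrywise integral of a matrix-valued function. -/
def matInt {m n : Type} (c d : ℝ) (F : ℝ → Matrix m n ℝ) : Matrix m n ℝ :=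
  Matrix.of fun i j => ∫ s in c..d, F s i j

section Data

variable {N : ℕ} (n : Fin (N + 1) → ℕ)

/-- `τ_k(s) = sᵏ / k!`. -/
def tau (k : ℕ) (s : ℝ) : ℝ := s ^ k / (k.factorial : ℝ)

/-- The matrix `T(s)`: it expresses `∂ₛᵏ x_p` at distance `s` from `a` through the derivatives
`∂ₛˡ x_p` at `a`, `l ≥ k`. -/
def Tmat (s : ℝ) : Matrix (CIdx n) (CIdx n) ℝ := Matrix.of fun c d =>
  if c.1 = d.1 ∧ c.2.val ≤ d.2.val then tau (d.2.val - c.2.val) s else 0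

/-- The matrix `Q(s)`: the entry for `∂ₛᵏ x_p` and the state `p` in the group `i` is
`τ_{i - 1 - k}(s)`. -/
def Qmat (s : ℝ) : Matrix (CIdx n) (StateIdx n) ℝ := Matrix.of fun c p =>
  if c.1 = p then tau (c.1.1.val - 1 - c.2.val) s else 0

/-- The matrix `U₁`, which places the highest derivatives in the list of all derivatives. -/
def U1 : Matrix (FIdx n) (StateIdx n) ℝ := Matrix.of fun f p =>
  if f.1 = p ∧ f.2.val = f.1.1.val then 1 else 0

/-- The matrix `U₂`, which places the absolutely continuous functions in the list of all
derivatives. -/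
def U2 : Matrix (FIdx n) (CIdx n) ℝ := Matrix.of fun f c =>
  if f.1 = c.1 ∧ f.2.val = c.2.val then 1 else 0

/-- The matrix that selects the rows of order `k = 0` and puts zero rows for the states of the
group `0`; for example `[0; T₁(s)]` is `E1 * T(s)` and `[0; Q₁(s)]` is `E1 * Q(s)`. -/
def E1 : Matrix (StateIdx n) (CIdx n) ℝ := Matrix.of fun p c =>
  if c.1 = p ∧ c.2.val = 0 then 1 else 0

/-- The matrix `G₀ = diag(I, 0)`. -/
def G0 : Matrix (StateIdx n) (StateIdx n) ℝ :=
  Matrix.diagonal fun p => if p.1.val = 0 then 1 else 0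

theorem continuous_tau (k : ℕ) : Continuous (tau k) := by
  unfold tau
  fun_prop

theorem continuous_Tmat : Continuous (Tmat n) := by
  refine continuous_matrix fun c d => ?_
  simp only [Tmat, Matrix.of_apply]
  split_ifs
  · exact continuous_tau _
  · exact continuous_const

theorem continuous_Qmat : Continuous (Qmat n) := by
  refine continuous_matrix fun c d => ?_
  simp only [Qmat, Matrix.of_apply]
  split_ifs
  · exact continuous_tau _
  · exact continuous_const

end Data

/-- Matrices of the ODE subsystem. -/
structure ODEParams (nx nw nu nr nz ny nv : ℕ) where
  A : Matrix (Fin nx) (Fin nx) ℝ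
  Bxw : Matrix (Fin nx) (Fin nw) ℝ
  Bxu : Matrix (Fin nx) (Fin nu) ℝ
  Bxr : Matrix (Fin nx) (Fin nr) ℝ
  Cz : Matrix (Fin nz) (Fin nx) ℝ
  Dzw : Matrix (Fin nz) (Fin nw) ℝ
  Dzu : Matrix (Fin nz) (Fin nu) ℝ
  Dzr : Matrix (Fin nz) (Fin nr) ℝ
  Cy : Matrix (Fin ny) (Fin nx) ℝ
  Dyw : Matrix (Fin ny) (Fin nw) ℝ
  Dyu : Matrix (Fin ny) (Fin nu) ℝ
  Dyr : Matrix (Fin ny) (Fin nr) ℝ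
  Cv : Matrix (Fin nv) (Fin nx) ℝ
  Dvw : Matrix (Fin nv) (Fin nw) ℝ
  Dvu : Matrix (Fin nv) (Fin nu) ℝ

/-- Parameters of the boundary conditions
`∫ₐᵇ B_I(s) (F x)(s) ds + B_v v - B [(C x)(a); (C x)(b)] = 0`. -/
structure BCParams (a b : ℝ) {N : ℕ} (n : Fin (N + 1) → ℕ) (nBC nv : ℕ) where
  B : Matrix (Fin nBC) (CIdx n ⊕ CIdx n) ℝ
  BI : ℝ → Matrix (Fin nBC) (FIdx n) ℝ
  Bv : Matrix (Fin nBC) (Fin nv) ℝ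
  memLp_BI : MatMemLp BI 2 (mu a b)

/-- Parameters of the in-domain dynamics of the PDE subsystem. -/
structure PDEParams (a b : ℝ) {N : ℕ} (n : Fin (N + 1) → ℕ) (nv nr : ℕ) where
  A0 : ℝ → Matrix (StateIdx n) (FIdx n) ℝ
  A1 : ℝ → ℝ → Matrix (StateIdx n) (FIdx n) ℝ
  A2 : ℝ → ℝ → Matrix (StateIdx n) (FIdx n) ℝ
  Bxv : ℝ → Matrix (StateIdx n) (Fin nv) ℝ
  Bxb : ℝ → Matrix (StateIdx n) (CIdx n ⊕ CIdx n) ℝ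
  Cr : ℝ → Matrix (Fin nr) (FIdx n) ℝ
  Drb : Matrix (Fin nr) (CIdx n ⊕ CIdx n) ℝ
  memLp_A0 : MatMemLp A0 ∞ (mu a b)
  memLp_A1 : MatMemLp (fun z : ℝ × ℝ => A1 z.1 z.2) 2 ((mu a b).prod (mu a b))
  memLp_A2 : MatMemLp (fun z : ℝ × ℝ => A2 z.1 z.2) 2 ((mu a b).prod (mu a b))
  memLp_Bxv : MatMemLp Bxv 2 (mu a b)
  memLp_Bxb : MatMemLp Bxb 2 (mu a b)
  memLp_Cr : MatMemLp Cr 2 (mu a b)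

namespace BCParams

variable {a b : ℝ} {N : ℕ} {n : Fin (N + 1) → ℕ} {nBC nv : ℕ} (G : BCParams a b n nBC nv)

/-- `B_T = B [T(0); T(b - a)] - ∫ₐᵇ B_I(s) U₂ T(s - a) ds`. -/
def BT : Matrix (Fin nBC) (CIdx n) ℝ :=
  G.B * Matrix.fromRows (Tmat n 0) (Tmat n (b - a))
    - matInt a b fun s => G.BI s * U2 n * Tmat n (s - a)

/-- The boundary conditions are admissible: the matrix `B_T` is invertible (in particular square,
that is, `n_BC = n_S`). -/
def Admissible : Prop := ∃ L : Matrix (CIdx n) (Fin nBC) ℝ, L * G.BT = 1 ∧ G.BT * L = 1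

open Classical in
/-- The inverse of `B_T` (and `0` if the boundary conditions are not admissible). -/
def BTinv : Matrix (CIdx n) (Fin nBC) ℝ := if h : G.Admissible then h.choose else 0

/-- `B_Q(s) = B_T⁻¹ (B_I(s) U₁ + ∫ₛᵇ B_I(θ) U₂ Q(θ - s) dθ - B [0; Q(b - s)])`. -/
def BQ (s : ℝ) : Matrix (CIdx n) (StateIdx n) ℝ :=
  G.BTinv * (G.BI s * U1 n + matInt s b (fun θ => G.BI θ * U2 n * Qmat n (θ - s))
    - G.B * Matrix.fromRows 0 (Qmat n (b - s)))

/-- `G₂(s, θ) = [0; T₁(s - a) B_Q(θ)]`. -/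
def G2 (s θ : ℝ) : Matrix (StateIdx n) (StateIdx n) ℝ := E1 n * Tmat n (s - a) * G.BQ θ

/-- `G₁(s, θ) = [0; Q₁(s - θ)] + G₂(s, θ)`. -/
def G1 (s θ : ℝ) : Matrix (StateIdx n) (StateIdx n) ℝ := E1 n * Qmat n (s - θ) + G.G2 s θ

/-- `G_v(s) = [0; T₁(s - a) B_T⁻¹ B_v]`. -/
def Gv (s : ℝ) : Matrix (StateIdx n) (Fin nv) ℝ := E1 n * Tmat n (s - a) * (G.BTinv * G.Bv)

/-- `R_{D,2}(s, θ) = U₂ T(s - a) B_Q(θ)`. -/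
def RD2 (s θ : ℝ) : Matrix (FIdx n) (StateIdx n) ℝ := U2 n * Tmat n (s - a) * G.BQ θ

/-- `R_{D,1}(s, θ) = R_{D,2}(s, θ) + U₂ Q(s - θ)`. -/
def RD1 (s θ : ℝ) : Matrix (FIdx n) (StateIdx n) ℝ := G.RD2 s θ + U2 n * Qmat n (s - θ)

theorem memLp_BQ : MatMemLp G.BQ 2 (mu a b) := by
  refine MatMemLp.mul (p := ∞) (q := 2) (MatMemLp.const _ _) (MatMemLp.sub (MatMemLp.add ?_ ?_) ?_)
  · exact MatMemLp.mul (p := 2) (q := ∞) G.memLp_BI (MatMemLp.const _ _)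
  · intro i j
    let K : ℝ × ℝ → Matrix (Fin nBC) (StateIdx n) ℝ :=
      fun z => if z.1 < z.2 then G.BI z.2 * U2 n * Qmat n (z.2 - z.1) else 0
    have hK0 : MatMemLp (fun z : ℝ × ℝ => G.BI z.2 * U2 n * Qmat n (z.2 - z.1)) 2
        ((mu a b).prod (mu a b)) :=
      MatMemLp.mul (p := 2) (q := ∞)
        (MatMemLp.mul (p := 2) (q := ∞) (MatMemLp.comp_snd G.memLp_BI) (MatMemLp.const _ _))
        (matMemLp_of_continuous₂ _
          ((continuous_Qmat n).comp (continuous_snd.sub continuous_fst)))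
    have hK : MatMemLp K 2 ((mu a b).prod (mu a b)) :=
      hK0.indicator (P := fun z : ℝ × ℝ => z.1 < z.2)
        (measurableSet_lt measurable_fst measurable_snd)
    have hint : MemLp (fun s => ∫ θ, K (s, θ) i j ∂(mu a b)) 2 (mu a b) := by
      have hker : MatMemLp (fun z : ℝ × ℝ => Matrix.of fun (_ _ : Unit) => K (z.1, z.2) i j) 2
        ((mu a b).prod (mu a b)) := fun _ _ => hK i j
      have hone : MemLp (fun _ : ℝ => (WithLp.toLp 2 fun _ => 1 : Vec Unit)) 2 (mu a b) :=
        memLp_const _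
      refine (memLp_congr_ae ?_).1 ((memLp_kernel
        (K := fun s θ => Matrix.of fun (_ _ : Unit) => K (s, θ) i j) hker (hone.toLp _)).eval_piLp ())
      filter_upwards [ae_memLp_kernel
        (K := fun s θ => Matrix.of fun (_ _ : Unit) => K (s, θ) i j) hker] with s hs
      refine ((EuclideanSpace.proj (𝕜 := ℝ) ()).integral_comp_comm
        (integrable_mv hs (Lp.memLp (hone.toLp _)))).symm.trans (integral_congr_ae ?_)
      filter_upwards [hone.coeFn_toLp] with θ hθ
      rw [hθ]
      simp [mv_apply]
    refine (memLp_congr_ae ?_).1 hint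
    filter_upwards [ae_restrict_mem measurableSet_Icc] with s hs
    rw [matInt, Matrix.of_apply, intervalIntegral.integral_of_le hs.2]
    have : (fun θ => K (s, θ) i j) =
        (Set.Ioi s).indicator fun θ => (G.BI θ * U2 n * Qmat n (θ - s)) i j := by
      funext θ
      by_cases h : s < θ <;> simp [K, Set.indicator, h]
    rw [this, integral_indicator measurableSet_Ioi, Measure.restrict_restrict measurableSet_Ioi]
    congr 2
    ext θ
    simp only [Set.mem_inter_iff, Set.mem_Ioi, Set.mem_Icc, Set.mem_Ioc]
    constructor
    · rintro ⟨h, -, h'⟩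
      exact ⟨h, h'⟩
    · rintro ⟨h, h'⟩
      exact ⟨h, hs.1.trans h.le, h'⟩
  · refine MatMemLp.mul (p := ∞) (q := 2) (MatMemLp.const _ _) (MatMemLp.fromRows (MatMemLp.const _ _) ?_)
    exact matMemLp_of_continuous _ ((continuous_Qmat n).comp (continuous_const.sub continuous_id))

theorem memLp_mul_BQ {l : Type} [Fintype l] (M : Matrix l (CIdx n) ℝ) :
    MatMemLp (fun z : ℝ × ℝ => M * Tmat n (z.1 - a) * G.BQ z.2) 2 ((mu a b).prod (mu a b)) :=
  MatMemLp.mul (p := ∞) (q := 2)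
    (MatMemLp.mul (p := ∞) (q := ∞) (MatMemLp.const _ _) (matMemLp_of_continuous₂ _
      ((continuous_Tmat n).comp (continuous_fst.sub continuous_const))))
    (MatMemLp.comp_snd G.memLp_BQ)

theorem memLp_mul_Q {l : Type} [Fintype l] (M : Matrix l (CIdx n) ℝ) :
    MatMemLp (fun z : ℝ × ℝ => M * Qmat n (z.1 - z.2)) 2 ((mu a b).prod (mu a b)) :=
  MatMemLp.mul (p := ∞) (q := 2) (MatMemLp.const _ _)
    (matMemLp_of_continuous₂ _ ((continuous_Qmat n).comp (continuous_fst.sub continuous_snd)))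

theorem memLp_mul_T {l k : Type} [Fintype l] [Fintype k] (M : Matrix l (CIdx n) ℝ)
    (M' : Matrix (CIdx n) k ℝ) :
    MatMemLp (fun s : ℝ => M * Tmat n (s - a) * M') 2 (mu a b) :=
  MatMemLp.mul (p := 2) (q := ∞)
    (MatMemLp.mul (p := ∞) (q := 2) (MatMemLp.const _ _) (matMemLp_of_continuous _
      ((continuous_Tmat n).comp (continuous_id.sub continuous_const)))) (MatMemLp.const _ _)

/-- The operator `T̂`, the 3-PI operator with parameters `{G₀, G₁, G₂}`. -/
def That : L2 a b (StateIdx n) →L[ℝ] L2 a b (StateIdx n) :=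
  threePI (fun _ => G0 n) G.G1 G.G2 (MatMemLp.const _ _)
    ((memLp_mul_Q _).add (G.memLp_mul_BQ _)) (G.memLp_mul_BQ _)

/-- The operator `T_v`, multiplication by `G_v`. -/
def Tv : Vec (Fin nv) →L[ℝ] L2 a b (StateIdx n) := funcOp G.Gv (memLp_mul_T _ _)

/-- The 4-PI parameters `Υ`; the operator maps `(v, D x)` to `((v, B x), F x)`. -/
def Upsilon :
    FourPIParams a b (Fin nv ⊕ (CIdx n ⊕ CIdx n)) (FIdx n) (Fin nv) (StateIdx n) where
  P := Matrix.fromRows 1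
    (Matrix.fromRows (G.BTinv * G.Bv) (Tmat n (b - a) * (G.BTinv * G.Bv)))
  Q1 s := Matrix.fromRows 0
    (Matrix.fromRows (G.BQ s) (Tmat n (b - a) * G.BQ s + Qmat n (b - s)))
  Q2 s := U2 n * Tmat n (s - a) * (G.BTinv * G.Bv)
  R0 _ := U1 n
  R1 := G.RD1
  R2 := G.RD2
  memLp_Q1 := (MatMemLp.const _ _).fromRows (G.memLp_BQ.fromRows
    ((MatMemLp.mul (p := ∞) (q := 2) (MatMemLp.const _ _) G.memLp_BQ).add
      (matMemLp_of_continuous _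
        ((continuous_Qmat n).comp (continuous_const.sub continuous_id)))))
  memLp_Q2 := memLp_mul_T _ _
  memLp_R0 := MatMemLp.const _ _
  memLp_R1 := (G.memLp_mul_BQ _).add (memLp_mul_Q _)
  memLp_R2 := G.memLp_mul_BQ _

end BCParams

/-- The 4-PI parameters `Ξ` of the in-domain dynamics. -/
def PDEParams.Xi {a b : ℝ} {N : ℕ} {n : Fin (N + 1) → ℕ} {nv nr : ℕ}
    (Gp : PDEParams a b n nv nr) :
    FourPIParams a b (Fin nr) (StateIdx n) (Fin nv ⊕ (CIdx n ⊕ CIdx n)) (FIdx n) where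
  P := Matrix.fromCols 0 Gp.Drb
  Q1 := Gp.Cr
  Q2 s := Matrix.fromCols (Gp.Bxv s) (Gp.Bxb s)
  R0 := Gp.A0
  R1 := Gp.A1
  R2 := Gp.A2
  memLp_Q1 := Gp.memLp_Cr
  memLp_Q2 := Gp.memLp_Bxv.fromCols Gp.memLp_Bxb
  memLp_R0 := Gp.memLp_A0
  memLp_R1 := Gp.memLp_A1
  memLp_R2 := Gp.memLp_A2

/-! ### Sobolev spaces and the domain -/

/-- The function `u` belongs to the Sobolev space `W_k[a, b]` (all weak derivatives up to the order
`k` are square-integrable), and `u` is its regular representative: the derivatives of order less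
than `k` are absolutely continuous on `[a, b]`, and those of order at most `k` are in `L₂`. -/
def IsSobolev (a b : ℝ) (k : ℕ) (u : ℝ → ℝ) : Prop :=
  (∀ l < k, AbsolutelyContinuousOnInterval (iteratedDerivWithin l u (Set.Icc a b)) a b) ∧
    ∀ l ≤ k, MemLp (iteratedDerivWithin l u (Set.Icc a b)) 2 (mu a b)

/-- The space `Wⁿ[a, b]` of the distributed states. -/
def Wn (a b : ℝ) {N : ℕ} (n : Fin (N + 1) → ℕ) : Type :=
  {f : StateIdx n → ℝ → ℝ // ∀ p, IsSobolev a b p.1.val (f p)}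

namespace Wn

variable {a b : ℝ} {N : ℕ} {n : Fin (N + 1) → ℕ}

/-- The vector of all the partial derivatives, of orders `0, …, i` for the group `i`, at `s`. -/
def F (f : Wn a b n) (s : ℝ) : Vec (FIdx n) :=
  WithLp.toLp 2 fun q => iteratedDerivWithin q.2.val (f.1 q.1) (Set.Icc a b) s

/-- The vector of all the absolutely continuous partial derivatives, of orders `0, …, i - 1` for
the group `i`, at `s`. -/
def C (f : Wn a b n) (s : ℝ) : Vec (CIdx n) :=
  WithLp.toLp 2 fun q => iteratedDerivWithin q.2.val (f.1 q.1) (Set.Icc a b) s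

/-- The vector of boundary values `[(C x)(a); (C x)(b)]`. -/
def Bd (f : Wn a b n) : Vec (CIdx n ⊕ CIdx n) :=
  WithLp.toLp 2 (Sum.elim (f.C a) (f.C b))

theorem memLp (f : Wn a b n) :
    MemLp (fun s => (WithLp.toLp 2 fun p => f.1 p s : Vec (StateIdx n))) 2 (mu a b) :=
  MemLp.of_eval_piLp fun p => by simpa using (f.2 p).2 0 (Nat.zero_le _)

/-- The class of the function in `L₂`. -/
def toL2 (f : Wn a b n) : L2 a b (StateIdx n) := f.memLp.toLp _

end Wn

/-- The set `X_v` of the functions in `Wⁿ` that satisfy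
`∫ₐᵇ B_I(s) (F x)(s) ds + B_v v - B [(C x)(a); (C x)(b)] = 0`. -/
def BCParams.X {a b : ℝ} {N : ℕ} {n : Fin (N + 1) → ℕ} {nBC nv : ℕ} (Gb : BCParams a b n nBC nv)
    (v : Vec (Fin nv)) : Set (Wn a b n) :=
  {f | (∫ s in a..b, mv (Gb.BI s) (f.F s)) + mv Gb.Bv v - mv Gb.B f.Bd = 0}

/-! ### Solutions -/

/-- `f` is locally square-integrable on `[0, ∞)`. -/
def L2e {E : Type} [NormedAddCommGroup E] (f : ℝ → E) : Prop :=
  ∀ T : ℝ, MemLp f 2 (volume.restrict (Set.Icc 0 T))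

/-- `f` is absolutely continuous on every `[0, T]`. -/
def LocAC {E : Type} [NormedAddCommGroup E] (f : ℝ → E) : Prop :=
  ∀ T : ℝ, 0 ≤ T → AbsolutelyContinuousOnInterval f 0 T

/-- `f` is locally in the Sobolev space `W₁` on `[0, ∞)`. -/
def W1e {E : Type} [NormedAddCommGroup E] [NormedSpace ℝ E] (f : ℝ → E) : Prop :=
  LocAC f ∧ L2e f ∧ L2e (deriv f)

section Model

variable {N : ℕ} {n : Fin (N + 1) → ℕ} {nx nw nu nr nz ny nv nBC : ℕ} {a b : ℝ}

/-- The set `𝒳_{w,u}` of the pairs `(x, f)` with `f ∈ X_v`, `v = C_v x + D_vw w + D_vu u`. -/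
def domX (Go : ODEParams nx nw nu nr nz ny nv) (Gb : BCParams a b n nBC nv) (w : Vec (Fin nw))
    (u : Vec (Fin nu)) : Set (Vec (Fin nx) × Wn a b n) :=
  {p | p.2 ∈ Gb.X (mv Go.Cv p.1 + mv Go.Dvw w + mv Go.Dvu u)}

/-- The tuple `(x, xh, z, y, v, r)` satisfies the GPDE with initial condition `(x0, xh0)` and input
`(w, u)`; `x` is the state of the ODE, `xh` the distributed state. -/
structure IsGPDESolution (Go : ODEParams nx nw nu nr nz ny nv) (Gb : BCParams a b n nBC nv)
    (Gp : PDEParams a b n nv nr) (x0 : Vec (Fin nx)) (xh0 : Wn a b n) (w : ℝ → Vec (Fin nw))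
    (u : ℝ → Vec (Fin nu)) (x : ℝ → Vec (Fin nx)) (xh : ℝ → Wn a b n) (z : ℝ → Vec (Fin nz))
    (y : ℝ → Vec (Fin ny)) (v : ℝ → Vec (Fin nv)) (r : ℝ → Vec (Fin nr)) : Prop where
  w_mem : L2e w
  u_mem : L2e u
  Bvw_mem : W1e fun t => mv (Gb.Bv * Go.Dvw) (w t)
  Bvu_mem : W1e fun t => mv (Gb.Bv * Go.Dvu) (u t)
  initial_mem : (x0, xh0) ∈ domX Go Gb (w 0) (u 0)
  z_mem : L2e z
  y_mem : L2e y
  v_mem : L2e v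
  r_mem : L2e r
  mem_domX : ∀ t, 0 ≤ t → (x t, xh t) ∈ domX Go Gb (w t) (u t)
  x_ac : LocAC x
  xh_ac : LocAC fun t => (xh t).toL2
  x_initial : x 0 = x0
  xh_initial : (xh 0).toL2 = xh0.toL2
  ode : ∀ᵐ t ∂(volume.restrict (Set.Ici 0)),
    HasDerivAt x (mv Go.A (x t) + mv Go.Bxw (w t) + mv Go.Bxu (u t) + mv Go.Bxr (r t)) t
  out_z : ∀ᵐ t ∂(volume.restrict (Set.Ici 0)),
    z t = mv Go.Cz (x t) + mv Go.Dzw (w t) + mv Go.Dzu (u t) + mv Go.Dzr (r t)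
  out_y : ∀ᵐ t ∂(volume.restrict (Set.Ici 0)),
    y t = mv Go.Cy (x t) + mv Go.Dyw (w t) + mv Go.Dyu (u t) + mv Go.Dyr (r t)
  out_v : ∀ᵐ t ∂(volume.restrict (Set.Ici 0)),
    v t = mv Go.Cv (x t) + mv Go.Dvw (w t) + mv Go.Dvu (u t)
  pde : ∀ᵐ t ∂(volume.restrict (Set.Ici 0)), ∃ d : L2 a b (StateIdx n),
    HasDerivAt (fun t => (xh t).toL2) d t ∧ ∀ᵐ s ∂(mu a b),
      d s = mv (Gp.A0 s) ((xh t).F s) + mv (Gp.Bxv s) (v t) + mv (Gp.Bxb s) (xh t).Bd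
        + (∫ θ in a..s, mv (Gp.A1 s θ) ((xh t).F θ)) + ∫ θ in s..b, mv (Gp.A2 s θ) ((xh t).F θ)
  out_r : ∀ᵐ t ∂(volume.restrict (Set.Ici 0)),
    r t = (∫ θ in a..b, mv (Gp.Cr θ) ((xh t).F θ)) + mv Gp.Drb (xh t).Bd

/-! ### The associated PIE -/

/-- The 4-PI operator `[D_rv, C_r; B_v, Â]` of the PDE subsystem: it maps `(v, D x)` to the output
`r` and the time derivative of the distributed state. -/
def subsystemOp (Gb : BCParams a b n nBC nv) (Gp : PDEParams a b n nv nr) :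
    RL2 a b (Fin nv) (StateIdx n) →L[ℝ] RL2 a b (Fin nr) (StateIdx n) :=
  Gp.Xi.op ∘L Gb.Upsilon.op

/-- The operator `𝒯 = [I, 0; T_v C_v, T̂]` of the PIE. -/
def pieT (Go : ODEParams nx nw nu nr nz ny nv) (Gb : BCParams a b n nBC nv) :
    RL2 a b (Fin nx) (StateIdx n) →L[ℝ] RL2 a b (Fin nx) (StateIdx n) :=
  blockOp (.id ℝ _) 0 (Gb.Tv ∘L matOp Go.Cv) Gb.That

/-- The operator `𝒜 = [A + B_xr D_rv C_v, B_xr C_r; B_v C_v, Â]` of the PIE. -/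
def pieA (Go : ODEParams nx nw nu nr nz ny nv) (Gb : BCParams a b n nBC nv)
    (Gp : PDEParams a b n nv nr) :
    RL2 a b (Fin nx) (StateIdx n) →L[ℝ] RL2 a b (Fin nx) (StateIdx n) :=
  blockOp (matOp Go.A + matOp Go.Bxr ∘L block11 (subsystemOp Gb Gp) ∘L matOp Go.Cv)
    (matOp Go.Bxr ∘L block12 (subsystemOp Gb Gp))
    (block21 (subsystemOp Gb Gp) ∘L matOp Go.Cv)
    (block22 (subsystemOp Gb Gp))

/-! ### Exponential stability -/

/-- The state `(x, f)` as an element of `ℝ^{n_x} × L₂`. -/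
def toRL2 (x : Vec (Fin nx)) (f : Wn a b n) : RL2 a b (Fin nx) (StateIdx n) :=
  WithLp.toLp 2 (x, f.toL2)

/-- The GPDE is exponentially stable in the norm of `ℝ^{n_x} × L₂`. -/
def ExpStableRL2 (Go : ODEParams nx nw nu nr nz ny nv) (Gb : BCParams a b n nBC nv)
    (Gp : PDEParams a b n nv nr) : Prop :=
  ∃ M α : ℝ, 0 < M ∧ 0 < α ∧ ∀ (x0 : Vec (Fin nx)) (xh0 : Wn a b n), (x0, xh0) ∈ domX Go Gb 0 0 →
    ∀ (x : ℝ → Vec (Fin nx)) (xh : ℝ → Wn a b n) (z : ℝ → Vec (Fin nz)) (y : ℝ → Vec (Fin ny))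
      (v : ℝ → Vec (Fin nv)) (r : ℝ → Vec (Fin nr)),
      IsGPDESolution Go Gb Gp x0 xh0 (fun _ => 0) (fun _ => 0) x xh z y v r →
        ∀ t : ℝ, 0 ≤ t → ‖toRL2 (x t) (xh t)‖ ≤ M * ‖toRL2 x0 xh0‖ * Real.exp (-α * t)

end Model

end

end GPDE

/-! With zero input the boundary input is `v = C_v x`, and the boundary conditions constrain the
distributed state `f`. Taylor's formula (`IsSobolev.taylor`, `Wn.C_eq`) expresses all lower
derivatives of `f` through their values at `a` and the highest derivatives `D f`. Inserted into the
boundary conditions, it gives a linear equation for `C f(a)` with matrix `B_T`. Admissibility makes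
it solvable (`BCParams.C_left_eq`), so `(x, D f)` determines `(x, f)` and everything that enters the
dynamics.

Consequently `𝒯 (x, D f) = (x, f)` (`pieT_eq`), and `𝒜 (x, D f)` is the right-hand side of the GPDE
(`pieA_eq`). Let `X(t) = (x(t), f(t))` and `φ(t) = (x(t), D f(t))`. For almost every `t`, `V = ⟨P X,
X⟩` satisfies `V' = 2⟨P X, X'⟩ = 2⟨P 𝒯φ, 𝒜φ⟩ ≤ -δ‖𝒯φ‖² = -δ‖X‖²`, by the operator inequality tested
at `φ(t)` (`inner_le_of_lyapunov_le`). Only `X = 𝒯φ` is differentiated in time, never `φ`.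

Since `ε‖X‖² ≤ V ≤ (‖P‖ + 1)‖X‖²` and `V` is absolutely continuous, a Grönwall argument yields
exponential decay (`norm_le_of_lyapunov`). -/

namespace GPDE

open Set

/-! ### Lyapunov's direct method for absolutely continuous curves. -/

section Lyapunov

open Set Filter Topology

variable {H : Type} [NormedAddCommGroup H] [InnerProductSpace ℝ H]

/-- If the increments of `g` are bounded by a multiple of those of an absolutely continuous `f`, then
`g` is absolutely continuous. -/
theorem _root_.AbsolutelyContinuousOnInterval.of_dist_le {X Y : Type*} [PseudoMetricSpace X]
    [PseudoMetricSpace Y] {f : ℝ → X} {g : ℝ → Y} {c d K : ℝ}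
    (hf : AbsolutelyContinuousOnInterval f c d)
    (h : ∀ s ∈ uIcc c d, ∀ t ∈ uIcc c d, dist (g s) (g t) ≤ K * dist (f s) (f t)) :
    AbsolutelyContinuousOnInterval g c d := by
  -- Absolute continuity means that the sums of increments tend to zero along this filter; the bound
  -- on the increments then permits a squeeze.
  have h0 : Tendsto (fun E : ℕ × (ℕ → ℝ × ℝ) =>
      K * ∑ i ∈ Finset.range E.1, dist (f (E.2 i).1) (f (E.2 i).2))
      (AbsolutelyContinuousOnInterval.totalLengthFilter ⊓
        𝓟 (AbsolutelyContinuousOnInterval.disjWithin c d)) (𝓝 0) := by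
    simpa using Tendsto.const_mul K hf
  refine squeeze_zero' (.of_forall fun E => Finset.sum_nonneg fun _ _ => dist_nonneg) ?_ h0
  filter_upwards [mem_inf_of_right (mem_principal_self _)] with E hE
  rw [Finset.mul_sum]
  exact Finset.sum_le_sum fun i hi => h _ (hE.1 i hi).1 _ (hE.1 i hi).2

/-- The curve is bounded on the interval, say by `C`, and a bounded quadratic form is Lipschitz on
the ball of radius `C` with constant `2‖P‖C`. -/
theorem _root_.AbsolutelyContinuousOnInterval.inner_map_self {X : ℝ → H} {c d : ℝ}
    (hX : AbsolutelyContinuousOnInterval X c d) (P : H →L[ℝ] H) :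
    AbsolutelyContinuousOnInterval (fun t => inner ℝ (P (X t)) (X t)) c d := by
  obtain ⟨C, hC⟩ := hX.exists_bound
  refine hX.of_dist_le (K := ‖P‖ * C + ‖P‖ * C) fun s hs t ht => ?_
  rw [Real.dist_eq, dist_eq_norm]
  have e : inner ℝ (P (X s)) (X s) - inner ℝ (P (X t)) (X t)
      = inner ℝ (P (X s)) (X s - X t) + inner ℝ (P (X s - X t)) (X t) := by
    simp only [map_sub, inner_sub_left, inner_sub_right]; ring
  have h1 : |inner ℝ (P (X s)) (X s - X t)| ≤ ‖P‖ * C * ‖X s - X t‖ :=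
    (abs_real_inner_le_norm _ _).trans (by
      gcongr; exact (P.le_opNorm _).trans (by gcongr; exact hC s hs))
  have h2 : |inner ℝ (P (X s - X t)) (X t)| ≤ ‖P‖ * C * ‖X s - X t‖ :=
    (abs_real_inner_le_norm _ _).trans (by
      calc ‖P (X s - X t)‖ * ‖X t‖ ≤ (‖P‖ * ‖X s - X t‖) * C := by
            gcongr
            · exact P.le_opNorm _
            · exact hC t ht
        _ = _ := by ring)
  rw [e, add_mul]
  exact (abs_add_le _ _).trans (add_le_add h1 h2)

/-- Grönwall with a derivative that exists only almost everywhere. The product `exp (c t) V t` is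
absolutely continuous, so it is the integral of its derivative, which is nonpositive almost
everywhere. -/
theorem le_mul_exp_of_deriv_le {V : ℝ → ℝ} {c T : ℝ} (hT : 0 ≤ T)
    (hV : AbsolutelyContinuousOnInterval V 0 T)
    (hd : ∀ᵐ t ∂(volume.restrict (Ici 0)), ∃ V', HasDerivAt V V' t ∧ V' ≤ -c * V t) :
    V T ≤ V 0 * Real.exp (-c * T) := by
  have hE : AbsolutelyContinuousOnInterval (fun t => Real.exp (c * t)) 0 T :=
    ContDiffOn.absolutelyContinuousOnInterval (by fun_prop)
  have hW := (hE.fun_mul hV).integral_deriv_eq_sub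
  have hneg : ∫ t in (0 : ℝ)..T, deriv (fun t => Real.exp (c * t) * V t) t ≤ 0 := by
    rw [intervalIntegral.integral_of_le hT]
    refine integral_nonpos_of_ae ?_
    have hsub : Ioc 0 T ⊆ Ici 0 := fun t ht => ht.1.le
    filter_upwards [ae_restrict_of_ae_restrict_of_subset hsub hd] with t ⟨V', h1, h2⟩
    have h3 : HasDerivAt (fun t => Real.exp (c * t)) (Real.exp (c * t) * (c * 1)) t :=
      ((hasDerivAt_id t).const_mul c).exp
    rw [(h3.fun_mul h1).deriv]
    have := mul_le_mul_of_nonneg_left h2 (Real.exp_pos (c * t)).le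
    simp only [Pi.zero_apply]
    linarith
  rw [hW] at hneg
  simp only [mul_zero, Real.exp_zero, one_mul, sub_nonpos] at hneg
  rw [neg_mul, Real.exp_neg, ← div_eq_mul_inv, le_div_iff₀ (Real.exp_pos _), mul_comm]
  exact hneg

/-- Lyapunov's direct method for absolutely continuous curves in a Hilbert space, with a quadratic
Lyapunov function. -/
theorem norm_le_of_lyapunov {P : H →L[ℝ] H} (hP : ∀ x y, inner ℝ (P x) y = inner ℝ x (P y))
    {ε δ : ℝ} (hε : 0 < ε) (hδ : 0 < δ) (hPε : ∀ x, ε * ‖x‖ ^ 2 ≤ inner ℝ (P x) x) {X : ℝ → H}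
    (hX : LocAC X)
    (hd : ∀ᵐ t ∂(volume.restrict (Ici 0)), ∃ d, HasDerivAt X d t ∧
      2 * inner ℝ (P (X t)) d ≤ -δ * ‖X t‖ ^ 2) {t : ℝ} (ht : 0 ≤ t) :
    ‖X t‖ ≤ √((‖P‖ + 1) / ε) * ‖X 0‖ * Real.exp (-(δ / (‖P‖ + 1) / 2) * t) := by
  -- The extra `1` keeps the divisor positive even when `P = 0`, which happens on the trivial space.
  have hK : 0 < ‖P‖ + 1 := by positivity
  have hupper : ∀ x, inner ℝ (P x) x ≤ (‖P‖ + 1) * ‖x‖ ^ 2 := fun x => by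
    have := (real_inner_le_norm (P x) x).trans
      (mul_le_mul_of_nonneg_right (P.le_opNorm x) (norm_nonneg _))
    nlinarith [sq_nonneg ‖x‖]
  -- The rate `c` is chosen so that `c V ≤ δ‖X‖²`, by the upper bound on `V`.
  have key := le_mul_exp_of_deriv_le (V := fun t => inner ℝ (P (X t)) (X t))
    (c := δ / (‖P‖ + 1)) ht ((hX t ht).inner_map_self P) (by
      filter_upwards [hd] with s ⟨d, h1, h2⟩
      refine ⟨_, (P.hasFDerivAt.comp_hasDerivAt s h1).inner ℝ h1, ?_⟩
      -- Symmetry of `P` makes the two terms of the product rule equal.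
      have e : inner ℝ (P d) (X s) = inner ℝ (P (X s)) d := by
        rw [hP, real_inner_comm]
      have h3 : δ / (‖P‖ + 1) * inner ℝ (P (X s)) (X s) ≤ δ * ‖X s‖ ^ 2 := by
        rw [div_mul_eq_mul_div, div_le_iff₀ hK]
        nlinarith [mul_le_mul_of_nonneg_left (hupper (X s)) hδ.le]
      simp only [Function.comp_apply]
      rw [e]
      linarith)
  -- The estimate is proved for squared norms; taking roots halves the rate and puts `(‖P‖ + 1) / ε`
  -- under a root.
  refine le_of_sq_le_sq ?_ (by positivity)
  rw [mul_pow, mul_pow, Real.sq_sqrt (by positivity), ← Real.exp_nat_mul, div_mul_eq_mul_div,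
    div_mul_eq_mul_div, le_div_iff₀ hε]
  have e : ((2 : ℕ) : ℝ) * (-(δ / (‖P‖ + 1) / 2) * t) = -(δ / (‖P‖ + 1)) * t := by
    push_cast; ring
  rw [e]
  calc ‖X t‖ ^ 2 * ε = ε * ‖X t‖ ^ 2 := mul_comm _ _
    _ ≤ _ := hPε _
    _ ≤ _ := key
    _ ≤ _ := mul_le_mul_of_nonneg_right (hupper _) (Real.exp_pos _).le

end Lyapunov

/-! ### Taylor's formula for Sobolev functions on an interval. -/

section Taylor

theorem tau_zero_left (s : ℝ) : tau 0 s = 1 := by simp [tau]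

theorem tau_succ_zero (k : ℕ) : tau (k + 1) 0 = 0 := by simp [tau]

theorem hasDerivAt_tau_const_sub (k : ℕ) (s θ : ℝ) :
    HasDerivAt (fun θ => tau (k + 1) (s - θ)) (-tau k (s - θ)) θ := by
  have h := (((hasDerivAt_id θ).const_sub s).pow (k + 1)).div_const ((k + 1).factorial : ℝ)
  refine h.congr_deriv ?_
  simp only [tau, Nat.factorial_succ, id]
  have : (k.factorial : ℝ) ≠ 0 := by positivity
  push_cast
  field_simp

/-- Integration by parts, with no boundary term at `s` because `tau (m + 1)` vanishes at `0`. This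
is the induction step of Taylor's formula. -/
theorem integral_tau_mul {g : ℝ → ℝ} {a s : ℝ} (hg : AbsolutelyContinuousOnInterval g a s)
    (m : ℕ) :
    ∫ θ in a..s, tau m (s - θ) * g θ =
      tau (m + 1) (s - a) * g a + ∫ θ in a..s, tau (m + 1) (s - θ) * deriv g θ := by
  have ht : AbsolutelyContinuousOnInterval (fun θ => tau (m + 1) (s - θ)) a s :=
    ContDiffOn.absolutelyContinuousOnInterval (by unfold tau; fun_prop)
  have h := ht.integral_mul_deriv_eq_deriv_mul hg
  simp only [(hasDerivAt_tau_const_sub m s _).deriv, neg_mul, intervalIntegral.integral_neg,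
    sub_self, tau_succ_zero] at h
  rw [h]
  ring

variable {a b : ℝ} {k : ℕ} {u : ℝ → ℝ}

theorem deriv_iteratedDerivWithin_Icc {l : ℕ} {s : ℝ} (hs : s ∈ Ioo a b) :
    deriv (iteratedDerivWithin l u (Icc a b)) s = iteratedDerivWithin (l + 1) u (Icc a b) s := by
  rw [iteratedDerivWithin_succ, derivWithin_of_mem_nhds (Icc_mem_nhds hs.1 hs.2)]

theorem IsSobolev.ac (hu : IsSobolev a b k u) {l : ℕ} (hl : l < k) {s : ℝ} (hs : s ∈ Icc a b) :
    AbsolutelyContinuousOnInterval (iteratedDerivWithin l u (Icc a b)) a s := by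
  refine (hu.1 l hl).mono ?_
  rw [uIcc_of_le hs.1, uIcc_of_le (hs.1.trans hs.2)]
  exact Icc_subset_Icc_right hs.2

/-- The ordinary derivative and the one within `[a, b]` are matched only at interior points; the
endpoints form a null set. -/
theorem integral_mul_deriv_iteratedDerivWithin {l : ℕ} {s : ℝ} (hs : s ∈ Icc a b) (h : ℝ → ℝ) :
    ∫ θ in a..s, h θ * deriv (iteratedDerivWithin l u (Icc a b)) θ =
      ∫ θ in a..s, h θ * iteratedDerivWithin (l + 1) u (Icc a b) θ := by
  rw [intervalIntegral.integral_of_le hs.1, intervalIntegral.integral_of_le hs.1,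
    integral_Ioc_eq_integral_Ioo, integral_Ioc_eq_integral_Ioo]
  refine setIntegral_congr_fun measurableSet_Ioo fun θ hθ => ?_
  rw [deriv_iteratedDerivWithin_Icc ⟨hθ.1, hθ.2.trans_le hs.2⟩]

/-- Taylor's formula with integral remainder for the derivatives of a Sobolev function. -/
theorem IsSobolev.taylor (hu : IsSobolev a b k u) {s : ℝ} (hs : s ∈ Icc a b) (m l : ℕ)
    (hl : l + m + 1 ≤ k) :
    iteratedDerivWithin l u (Icc a b) s =
      ∑ j ∈ Finset.range (m + 1), tau j (s - a) * iteratedDerivWithin (l + j) u (Icc a b) a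
        + ∫ θ in a..s, tau m (s - θ) * iteratedDerivWithin (l + m + 1) u (Icc a b) θ := by
  induction m with
  | zero =>
    have h := (hu.ac (l := l) (by omega) hs).integral_deriv_eq_sub
    have h' := integral_mul_deriv_iteratedDerivWithin (u := u) (l := l) hs fun _ => 1
    simp only [one_mul] at h'
    rw [h'] at h
    simp [tau_zero_left, h]
  | succ m ih =>
    -- Integrating the remainder by parts splits off the term `j = m + 1` and raises the order of
    -- the remainder by one.
    rw [ih (by omega), integral_tau_mul (hu.ac (by omega) hs),
      integral_mul_deriv_iteratedDerivWithin hs, Finset.sum_range_succ _ (m + 1), ← add_assoc]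
    rfl

end Taylor

/-! ### Matrix-vector calculus under the integral sign, and Fubini on a triangle. -/

section Integrals

set_option linter.unusedSectionVars false

variable {a b : ℝ} {m n l : Type} [Fintype m] [Fintype n] [Fintype l]

theorem mv_mv (M : Matrix l m ℝ) (M' : Matrix m n ℝ) (x : Vec n) :
    mv M (mv M' x) = mv (M * M') x := by
  simp [mv, Matrix.mulVec_mulVec]

theorem sub_mv (M M' : Matrix m n ℝ) (x : Vec n) : mv (M - M') x = mv M x - mv M' x := by
  simp [mv, Matrix.sub_mulVec]

theorem one_mv [DecidableEq n] (x : Vec n) : mv (1 : Matrix n n ℝ) x = x := by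
  simp [mv]

theorem mv_zero (M : Matrix m n ℝ) : mv M (0 : Vec n) = 0 := by
  simp [mv]

theorem integrable_intervalIntegrable {E : Type} [NormedAddCommGroup E] {f : ℝ → E}
    (hf : Integrable f (mu a b)) {c d : ℝ} (hc : c ∈ Icc a b) (hd : d ∈ Icc a b) :
    IntervalIntegrable f volume c d := by
  refine IntegrableOn.intervalIntegrable (IntegrableOn.mono_set hf ?_)
  exact uIcc_subset_Icc hc hd

theorem mv_intervalIntegral (M : Matrix m n ℝ) {f : ℝ → Vec n} {c d : ℝ}
    (hf : IntervalIntegrable f volume c d) :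
    mv M (∫ s in c..d, f s) = ∫ s in c..d, mv M (f s) :=
  ((matOp M).intervalIntegral_comp_comm hf).symm

theorem intervalIntegral_apply {f : ℝ → Vec n} {c d : ℝ}
    (hf : IntervalIntegrable f volume c d) (i : n) :
    (∫ s in c..d, f s) i = ∫ s in c..d, f s i :=
  ((EuclideanSpace.proj (𝕜 := ℝ) i).intervalIntegral_comp_comm hf).symm

theorem matInt_mv {F : ℝ → Matrix m n ℝ} {c d : ℝ}
    (hF : ∀ i j, IntervalIntegrable (fun s => F s i j) volume c d) (x : Vec n) :
    mv (matInt c d F) x = ∫ s in c..d, mv (F s) x := by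
  classical
  -- Expansion in the standard basis reduces vector-valued integrability to that of the scalar
  -- entries.
  have e : ∀ s, mv (F s) x = ∑ i, (∑ j, F s i j * x j) • EuclideanSpace.single i (1 : ℝ) := by
    intro s
    ext i
    simp [mv_apply, Finset.sum_apply, Pi.single_apply]
  have hint : IntervalIntegrable (fun s => mv (F s) x) volume c d := by
    have h1 : ∀ i, IntervalIntegrable (fun s => ∑ j, F s i j * x j) volume c d := fun i => by
      simpa only [Finset.sum_fn] using
        IntervalIntegrable.sum Finset.univ fun j _ => (hF i j).mul_const (x j)
    simp only [e]
    simpa only [Finset.sum_fn] using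
      IntervalIntegrable.sum Finset.univ fun i _ =>
        (⟨(h1 i).1.smul_const _, (h1 i).2.smul_const _⟩ : IntervalIntegrable
          (fun s => (∑ j, F s i j * x j) • EuclideanSpace.single i (1 : ℝ)) volume c d)
  ext i
  rw [intervalIntegral_apply hint, mv_apply]
  simp only [mv_apply]
  rw [intervalIntegral.integral_finsetSum fun j _ => (hF i j).mul_const _]
  simp [matInt, intervalIntegral.integral_mul_const]

theorem intervalIntegral_eq_mu {E : Type} [NormedAddCommGroup E] [NormedSpace ℝ E] (hab : a ≤ b)
    (f : ℝ → E) : ∫ s in a..b, f s = ∫ s, f s ∂(mu a b) := by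
  rw [intervalIntegral.integral_of_le hab, integral_Icc_eq_integral_Ioc]

/-- Turns a variable limit of integration into a cut-off under a fixed measure, the form that
Fubini's theorem requires. -/
theorem integral_mu_indicator_Iic {E : Type} [NormedAddCommGroup E] [NormedSpace ℝ E] {s : ℝ}
    (hs : s ∈ Icc a b) (f : ℝ → E) :
    ∫ θ, (if θ ≤ s then f θ else 0) ∂(mu a b) = ∫ θ in a..s, f θ := by
  have : (fun θ => if θ ≤ s then f θ else 0) = (Iic s).indicator f := by
    funext θ; simp [indicator]
  rw [this, integral_indicator measurableSet_Iic, Measure.restrict_restrict measurableSet_Iic,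
    intervalIntegral.integral_of_le hs.1, ← integral_Icc_eq_integral_Ioc]
  congr 2
  ext θ
  simp only [mem_inter_iff, mem_Iic, mem_Icc]
  exact ⟨fun h => ⟨h.2.1, h.1⟩, fun h => ⟨h.2, h.1, h.2.trans hs.2⟩⟩

theorem integral_mu_indicator_Ici {E : Type} [NormedAddCommGroup E] [NormedSpace ℝ E] {s : ℝ}
    (hs : s ∈ Icc a b) (f : ℝ → E) :
    ∫ θ, (if s ≤ θ then f θ else 0) ∂(mu a b) = ∫ θ in s..b, f θ := by
  have : (fun θ => if s ≤ θ then f θ else 0) = (Ici s).indicator f := by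
    funext θ; simp [indicator]
  rw [this, integral_indicator measurableSet_Ici, Measure.restrict_restrict measurableSet_Ici,
    intervalIntegral.integral_of_le hs.2, ← integral_Icc_eq_integral_Ioc]
  congr 2
  ext θ
  simp only [mem_inter_iff, mem_Ici, mem_Icc]
  exact ⟨fun h => ⟨h.1, h.2.2⟩, fun h => ⟨h.1, hs.1.trans h.1, h.2⟩⟩

theorem MatMemLp.integrable {X : Type} [MeasurableSpace X] {μ : Measure X} [IsFiniteMeasure μ]
    {F : X → Matrix m n ℝ} (hF : MatMemLp F 2 μ) (i : m) (j : n) :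
    Integrable (fun s => F s i j) μ :=
  (hF i j).integrable (by norm_num)

/-- Exchange of the order of integration on the triangle `{θ ≤ s}` for a matrix kernel that is the
product of a square-integrable function and a continuous one. -/
theorem integral_mv_triangle (hab : a ≤ b) {M : ℝ → Matrix l m ℝ} (hM : MatMemLp M 2 (mu a b))
    {Q : ℝ → Matrix m n ℝ} (hQ : Continuous Q) {d : ℝ → Vec n} (hd : MemLp d 2 (mu a b)) :
    ∫ s in a..b, mv (M s) (∫ θ in a..s, mv (Q (s - θ)) (d θ)) =
      ∫ θ in a..b, mv (matInt θ b fun s => M s * Q (s - θ)) (d θ) := by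
  -- The triangle kernel extended by zero to the square. It is square-integrable, which supplies the
  -- integrability needed to swap the integrals.
  let K : ℝ × ℝ → Matrix l n ℝ := fun z => if z.2 ≤ z.1 then M z.1 * Q (z.1 - z.2) else 0
  have hK0 : MatMemLp (fun z : ℝ × ℝ => M z.1 * Q (z.1 - z.2)) 2 ((mu a b).prod (mu a b)) :=
    MatMemLp.mul (p := 2) (q := ∞) (fun i j => (hM i j).comp_fst (mu a b))
      (matMemLp_of_continuous₂ _ (hQ.comp (continuous_fst.sub continuous_snd)))
  have hK : MatMemLp K 2 ((mu a b).prod (mu a b)) :=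
    hK0.indicator (P := fun z : ℝ × ℝ => z.2 ≤ z.1)
      (measurableSet_le measurable_snd measurable_fst)
  have hint : Integrable (fun z : ℝ × ℝ => mv (K z) (d z.2)) ((mu a b).prod (mu a b)) :=
    integrable_mv hK (hd.comp_snd (mu a b))
  have hswap := integral_integral_swap (f := fun s θ => mv (K (s, θ)) (d θ)) hint
  rw [intervalIntegral_eq_mu hab, intervalIntegral_eq_mu hab]
  refine Eq.trans ?_ (hswap.trans ?_)
  · refine integral_congr_ae ?_
    filter_upwards [ae_restrict_mem measurableSet_Icc] with s hs
    have hQs : Integrable (fun θ => mv (Q (s - θ)) (d θ)) (mu a b) :=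
      integrable_mv (matMemLp_of_continuous _ (hQ.comp (continuous_const.sub continuous_id))) hd
    rw [mv_intervalIntegral _ (integrable_intervalIntegrable hQs ⟨le_rfl, hab⟩ hs),
      ← integral_mu_indicator_Iic hs]
    refine integral_congr_ae (.of_forall fun θ => ?_)
    by_cases h : θ ≤ s <;> simp [K, h, mv_mv, zero_mv]
  · refine integral_congr_ae ?_
    filter_upwards [ae_restrict_mem measurableSet_Icc] with θ hθ
    have hMQ : MatMemLp (fun s => M s * Q (s - θ)) 2 (mu a b) :=
      MatMemLp.mul (p := 2) (q := ∞) hM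
        (matMemLp_of_continuous _ (hQ.comp (continuous_id.sub continuous_const)))
    rw [matInt_mv fun i j => integrable_intervalIntegrable (hMQ.integrable i j) hθ ⟨hab, le_rfl⟩,
      ← integral_mu_indicator_Ici hθ]
    refine integral_congr_ae (.of_forall fun s => ?_)
    by_cases h : θ ≤ s <;> simp [K, h, zero_mv]

end Integrals

noncomputable section

/-! ### Reconstruction of derivatives and values from `D f` and `C f`. -/

namespace Wn

variable {a b : ℝ} {N : ℕ} {n : Fin (N + 1) → ℕ}

/-- The vector of the partial derivatives of highest order, `i` for the group `i`, at `s`. -/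
def D (f : Wn a b n) (s : ℝ) : Vec (StateIdx n) :=
  WithLp.toLp 2 fun p => iteratedDerivWithin p.1.val (f.1 p) (Icc a b) s

theorem memLp_D (f : Wn a b n) : MemLp f.D 2 (mu a b) :=
  MemLp.of_eval_piLp fun p => (f.2 p).2 _ le_rfl

theorem memLp_F (f : Wn a b n) : MemLp f.F 2 (mu a b) :=
  MemLp.of_eval_piLp fun q => (f.2 q.1).2 _ (Nat.lt_succ_iff.1 q.2.2)

theorem memLp_C (f : Wn a b n) : MemLp f.C 2 (mu a b) :=
  MemLp.of_eval_piLp fun q => (f.2 q.1).2 _ q.2.2.le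

theorem C_apply (f : Wn a b n) (s : ℝ) (p : StateIdx n) (k : Fin p.1.val) :
    f.C s ⟨p, k⟩ = iteratedDerivWithin k (f.1 p) (Icc a b) s := rfl

theorem D_apply (f : Wn a b n) (s : ℝ) (p : StateIdx n) :
    f.D s p = iteratedDerivWithin p.1.val (f.1 p) (Icc a b) s := rfl

theorem F_apply (f : Wn a b n) (s : ℝ) (p : StateIdx n) (k : Fin (p.1.val + 1)) :
    f.F s ⟨p, k⟩ = iteratedDerivWithin k (f.1 p) (Icc a b) s := rfl

theorem integrable_Q_D (f : Wn a b n) (s : ℝ) :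
    Integrable (fun θ => mv (Qmat n (s - θ)) (f.D θ)) (mu a b) :=
  integrable_mv (matMemLp_of_continuous _
    ((continuous_Qmat n).comp (continuous_const.sub continuous_id))) f.memLp_D

/-- Componentwise this is Taylor's formula carried to the highest derivative, so that the remainder
involves only `D f`. -/
theorem C_eq (f : Wn a b n) {s : ℝ} (hs : s ∈ Icc a b) :
    f.C s = mv (Tmat n (s - a)) (f.C a) + ∫ θ in a..s, mv (Qmat n (s - θ)) (f.D θ) := by
  have hint := integrable_intervalIntegrable (f.integrable_Q_D s)
    (left_mem_Icc.2 (hs.1.trans hs.2)) hs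
  ext ⟨p, k⟩
  -- For order `k` in group `i` the remainder kernel has degree `m = i - 1 - k`, and the derivative
  -- under the integral has order `k + m + 1 = i`.
  obtain ⟨m, hm⟩ : ∃ m, p.1.val = k.val + (m + 1) := ⟨p.1.val - k.val - 1, by omega⟩
  have ht := (f.2 p).taylor hs m k.val (by omega)
  rw [PiLp.add_apply, intervalIntegral_apply hint, C_apply, ht]
  congr 1
  · rw [mv_apply, Fintype.sum_sigma, Finset.sum_eq_single p]
    · have e : ∀ j : Fin p.1.val, Tmat n (s - a) ⟨p, k⟩ ⟨p, j⟩ * f.C a ⟨p, j⟩ =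
          (fun j : ℕ => (if k.val ≤ j then tau (j - k.val) (s - a) else 0) *
            iteratedDerivWithin j (f.1 p) (Icc a b) a) j.val := fun j => by
        simp [Tmat, C_apply]
      -- The row of `T` vanishes for `j < k`; splitting the range at `k` discards these terms and
      -- shifts the others into the Taylor sum.
      rw [Finset.sum_congr rfl fun j _ => e j, Fin.sum_univ_eq_sum_range (n := p.1.val)
        (fun j : ℕ => (if k.val ≤ j then tau (j - k.val) (s - a) else 0) *
            iteratedDerivWithin j (f.1 p) (Icc a b) a), congrArg Finset.range hm,
        Finset.sum_range_add _ k.val (m + 1),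
        Finset.sum_eq_zero (s := Finset.range k.val), zero_add]
      · simp
      · intro j hj
        simp [not_le.2 (Finset.mem_range.1 hj)]
    · intro p' _ hp
      refine Finset.sum_eq_zero fun j _ => ?_
      simp [Tmat, hp.symm]
    · simp
  · refine intervalIntegral.integral_congr fun θ _ => ?_
    have e : p.1.val - 1 - k.val = m := by omega
    have e' : k.val + m + 1 = p.1.val := by omega
    simp [mv_apply, Qmat, e, e', D_apply]

/-- A derivative of order `i` in group `i` is an entry of `D f`, one of lower order an entry of `C
f`, so exactly one of the two products contributes. -/
theorem F_eq (f : Wn a b n) (s : ℝ) : f.F s = mv (U1 n) (f.D s) + mv (U2 n) (f.C s) := by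
  ext ⟨p, k⟩
  have h1 : mv (U1 n) (f.D s) ⟨p, k⟩ = if k.val = p.1.val then f.D s p else 0 := by
    rw [mv_apply, Finset.sum_eq_single p]
    · simp [U1]
    · intro p' _ hp
      simp [U1, hp.symm]
    · simp
  have h2 : mv (U2 n) (f.C s) ⟨p, k⟩ = ∑ j : Fin p.1.val, if k.val = j.val then
      f.C s ⟨p, j⟩ else 0 := by
    rw [mv_apply, Fintype.sum_sigma, Finset.sum_eq_single p]
    · simp [U2]
    · intro p' _ hp
      refine Finset.sum_eq_zero fun j _ => ?_
      simp [U2, hp.symm]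
    · simp
  rw [PiLp.add_apply, h1, h2, F_apply]
  by_cases hk : k.val = p.1.val
  · rw [if_pos hk, Finset.sum_eq_zero, add_zero, D_apply, hk]
    intro j _
    rw [if_neg (by omega)]
  · rw [if_neg hk, zero_add, Finset.sum_eq_single (⟨k.val, by omega⟩ : Fin p.1.val)]
    · simp [C_apply]
    · intro j _ hj
      rw [if_neg fun h => hj (Fin.ext h.symm)]
    · simp

/-- In group `0` a component is its own highest derivative; in every other group it is the
order-zero entry of `C f`. -/
theorem val_eq (f : Wn a b n) (s : ℝ) :
    (WithLp.toLp 2 fun p => f.1 p s : Vec (StateIdx n)) =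
      mv (G0 n) (f.D s) + mv (E1 n) (f.C s) := by
  ext p
  have h1 : mv (G0 n) (f.D s) p = if p.1.val = 0 then f.D s p else 0 := by
    rw [mv_apply, Finset.sum_eq_single p]
    · simp [G0]
    · intro p' _ hp
      simp [G0, hp.symm]
    · simp
  have h2 : mv (E1 n) (f.C s) p = ∑ j : Fin p.1.val, if j.val = 0 then f.C s ⟨p, j⟩ else 0 := by
    rw [mv_apply, Fintype.sum_sigma, Finset.sum_eq_single p]
    · simp [E1]
    · intro p' _ hp
      refine Finset.sum_eq_zero fun j _ => ?_
      simp [E1, hp]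
    · simp
  rw [PiLp.add_apply, h1, h2]
  by_cases hk : p.1.val = 0
  · rw [if_pos hk, Finset.sum_eq_zero, add_zero, D_apply, hk, iteratedDerivWithin_zero]
    intro j _
    exact absurd j.2 (by omega)
  · rw [if_neg hk, zero_add,
      Finset.sum_eq_single (⟨0, Nat.pos_of_ne_zero hk⟩ : Fin p.1.val)]
    · simp [C_apply]
    · intro j _ hj
      rw [if_neg fun h => hj (Fin.ext h)]
    · simp

theorem Tmat_zero : Tmat n 0 = 1 := by
  ext ⟨p, k⟩ ⟨p', k'⟩
  by_cases h : p = p'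
  · subst h
    by_cases hk : k = k'
    · subst hk
      simp [Tmat, tau_zero_left]
    · have hne : k.val ≠ k'.val := fun h => hk (Fin.ext h)
      rw [Matrix.one_apply_ne (by simpa using hk)]
      simp only [Tmat, Matrix.of_apply, true_and]
      split_ifs with hle
      · obtain ⟨j, hj⟩ : ∃ j, k'.val - k.val = j + 1 := ⟨k'.val - k.val - 1, by omega⟩
        rw [hj, tau_succ_zero]
      · rfl
  · rw [Matrix.one_apply_ne (fun e => h (congrArg Sigma.fst e))]
    simp [Tmat, h]

end Wn

end

noncomputable section

/-! ### Evaluation of PI operators on explicit representatives. -/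

section PIFormulas

variable {a b : ℝ} {m n p q : Type} [Fintype m] [Fintype n] [Fintype p] [Fintype q]

/-- The operators act on classes in `L₂`, while the Sobolev identities concern functions; the two
differ only on a null set. -/
theorem intervalIntegral_mv_toLp {g : ℝ → Vec n} (hg : MemLp g 2 (mu a b)) {c d : ℝ}
    (hc : c ∈ Icc a b) (hd : d ∈ Icc a b) (K : ℝ → Matrix m n ℝ) :
    ∫ θ in c..d, mv (K θ) (hg.toLp g θ) = ∫ θ in c..d, mv (K θ) (g θ) := by
  refine intervalIntegral.integral_congr_ae ?_
  filter_upwards [(ae_restrict_iff' measurableSet_Icc).1 hg.coeFn_toLp] with θ hθ hm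
  rw [hθ (uIcc_subset_Icc hc hd (uIoc_subset_uIcc hm))]

theorem threePI_toLp_coe {g : ℝ → Vec n} (hg : MemLp g 2 (mu a b)) {R0 : ℝ → Matrix m n ℝ}
    {R1 R2 : ℝ → ℝ → Matrix m n ℝ} (h0 : MatMemLp R0 ∞ (mu a b))
    (h1 : MatMemLp (fun z : ℝ × ℝ => R1 z.1 z.2) 2 ((mu a b).prod (mu a b)))
    (h2 : MatMemLp (fun z : ℝ × ℝ => R2 z.1 z.2) 2 ((mu a b).prod (mu a b))) :
    ∀ᵐ s ∂(mu a b), threePI R0 R1 R2 h0 h1 h2 (hg.toLp g) s =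
      mv (R0 s) (g s) + (∫ θ in a..s, mv (R1 s θ) (g θ)) + ∫ θ in s..b, mv (R2 s θ) (g θ) := by
  filter_upwards [threePI_coe R0 R1 R2 h0 h1 h2 (hg.toLp g), hg.coeFn_toLp,
    ae_restrict_mem measurableSet_Icc] with s hs hgs hm
  have hab : a ≤ b := hm.1.trans hm.2
  rw [hs, hgs, intervalIntegral_mv_toLp hg ⟨le_rfl, hab⟩ hm,
    intervalIntegral_mv_toLp hg hm ⟨hab, le_rfl⟩]

/-- The second row of every 4-PI operator and the sum `T_v v + T̂ g` both have this form, so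
identities between classes reduce to pointwise formulas. -/
theorem funcOp_add_threePI_eq {Q : ℝ → Matrix m p ℝ} (hQ : MatMemLp Q 2 (mu a b)) (u : Vec p)
    {g : ℝ → Vec n} (hg : MemLp g 2 (mu a b)) {R0 : ℝ → Matrix m n ℝ}
    {R1 R2 : ℝ → ℝ → Matrix m n ℝ} (h0 : MatMemLp R0 ∞ (mu a b))
    (h1 : MatMemLp (fun z : ℝ × ℝ => R1 z.1 z.2) 2 ((mu a b).prod (mu a b)))
    (h2 : MatMemLp (fun z : ℝ × ℝ => R2 z.1 z.2) 2 ((mu a b).prod (mu a b))) {h : L2 a b m}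
    (hh : ∀ᵐ s ∂(mu a b), h s = mv (Q s) u + (mv (R0 s) (g s)
      + (∫ θ in a..s, mv (R1 s θ) (g θ)) + ∫ θ in s..b, mv (R2 s θ) (g θ))) :
    funcOp Q hQ u + threePI R0 R1 R2 h0 h1 h2 (hg.toLp g) = h := by
  refine Lp.ext ?_
  have hu : ∀ᵐ s ∂(mu a b), funcOp Q hQ u s = mv (Q s) u := (memLp_mv_const hQ u).coeFn_toLp
  filter_upwards [Lp.coeFn_add (funcOp Q hQ u) (threePI R0 R1 R2 h0 h1 h2 (hg.toLp g)), hu,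
    threePI_toLp_coe hg h0 h1 h2, hh] with s e1 e2 e3 e4
  rw [e1, Pi.add_apply, e2, e3, e4]

theorem FourPIParams.op_eq (hab : a ≤ b) (S : FourPIParams a b m p n q) {u : Vec n} {g : ℝ → Vec q}
    (hg : MemLp g 2 (mu a b)) {U : Vec m} {h : L2 a b p}
    (hU : U = mv S.P u + ∫ θ in a..b, mv (S.Q1 θ) (g θ))
    (hh : ∀ᵐ s ∂(mu a b), h s = mv (S.Q2 s) u + (mv (S.R0 s) (g s)
      + (∫ θ in a..s, mv (S.R1 s θ) (g θ)) + ∫ θ in s..b, mv (S.R2 s θ) (g θ))) :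
    S.op (WithLp.toLp 2 (u, hg.toLp g)) = WithLp.toLp 2 (U, h) := by
  have e1 : mv S.P u + ∫ θ, mv (S.Q1 θ) (hg.toLp g θ) ∂(mu a b) = U := by
    rw [hU, ← intervalIntegral_eq_mu hab,
      intervalIntegral_mv_toLp hg ⟨le_rfl, hab⟩ ⟨hab, le_rfl⟩]
  have e2 := funcOp_add_threePI_eq S.memLp_Q2 u hg S.memLp_R0 S.memLp_R1 S.memLp_R2 hh
  exact congrArg (WithLp.toLp 2) (Prod.ext e1 e2)

end PIFormulas

/-! ### Solving the boundary conditions for the state. -/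

namespace BCParams

variable {a b : ℝ} {N : ℕ} {n : Fin (N + 1) → ℕ} {nBC nv : ℕ} (G : BCParams a b n nBC nv)

theorem BTinv_mul_BT (h : G.Admissible) : G.BTinv * G.BT = 1 := by
  rw [BTinv, dif_pos h]
  exact h.choose_spec.1

theorem BT_mul_BTinv (h : G.Admissible) : G.BT * G.BTinv = 1 := by
  rw [BTinv, dif_pos h]
  exact h.choose_spec.2

variable {G} {f : Wn a b n} {v : Vec (Fin nv)}

/-- Taylor's formula at the two endpoints: at `a` the matrix is `T(0) = 1` and there is no integral,
hence the zero block. -/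
theorem _root_.GPDE.Wn.Bd_eq (hab : a ≤ b) (f : Wn a b n) :
    f.Bd = mv (Matrix.fromRows (Tmat n 0) (Tmat n (b - a))) (f.C a)
      + ∫ θ in a..b, mv (Matrix.fromRows 0 (Qmat n (b - θ)) :
          Matrix (CIdx n ⊕ CIdx n) (StateIdx n) ℝ) (f.D θ) := by
  have hQ : MatMemLp (fun θ => (Matrix.fromRows 0 (Qmat n (b - θ)) :
      Matrix (CIdx n ⊕ CIdx n) (StateIdx n) ℝ)) 2 (mu a b) :=
    (MatMemLp.const _ _).fromRows (matMemLp_of_continuous _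
      ((continuous_Qmat n).comp (continuous_const.sub continuous_id)))
  have hl : a ∈ Icc a b := ⟨le_rfl, hab⟩
  have hr : b ∈ Icc a b := ⟨hab, le_rfl⟩
  have hint := integrable_intervalIntegrable (integrable_mv hQ f.memLp_D) hl hr
  ext (c | c)
  · rw [PiLp.add_apply, intervalIntegral_apply hint]
    have e1 : mv (Matrix.fromRows (Tmat n 0) (Tmat n (b - a))) (f.C a) (Sum.inl c) =
      mv (Tmat n 0) (f.C a) c := rfl
    have e2 : ∀ θ, mv (Matrix.fromRows 0 (Qmat n (b - θ)) :
      Matrix (CIdx n ⊕ CIdx n) (StateIdx n) ℝ) (f.D θ) (Sum.inl c) = 0 := fun θ => by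
      simp [mv_apply]
    simp only [e2, intervalIntegral.integral_zero, add_zero]
    rw [e1, Wn.Tmat_zero, one_mv]
    rfl
  · have hC := congrArg (fun x : Vec (CIdx n) => x c) (f.C_eq hr)
    simp only [PiLp.add_apply] at hC
    rw [intervalIntegral_apply
      (integrable_intervalIntegrable (f.integrable_Q_D b) hl hr)] at hC
    rw [PiLp.add_apply, intervalIntegral_apply hint]
    exact hC

/-- Put `F f = U₁ D f + U₂ C f` and Taylor's formula into the boundary condition. The coefficient of
`C f(a)` is `B_T`, and after Fubini that of `D f(θ)` is `-B_T B_Q(θ)` when both are collected on one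
side. The factor `B_T` is kept because it cancels the inverse inside `B_Q`. -/
theorem BT_mv_C (hab : a ≤ b) (hadm : G.Admissible) (hf : f ∈ G.X v) :
    mv G.BT (f.C a) = mv G.Bv v + mv G.BT (∫ θ in a..b, mv (G.BQ θ) (f.D θ)) := by
  have hl : a ∈ Icc a b := ⟨le_rfl, hab⟩
  have hr : b ∈ Icc a b := ⟨hab, le_rfl⟩
  have ii {l : Type} [Fintype l] {M : ℝ → Matrix l (StateIdx n) ℝ} (hM : MatMemLp M 2 (mu a b)) :
      IntervalIntegrable (fun θ => mv (M θ) (f.D θ)) volume a b :=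
    integrable_intervalIntegrable (integrable_mv hM f.memLp_D) hl hr
  have hBIU1 : MatMemLp (fun θ => G.BI θ * U1 n) 2 (mu a b) :=
    MatMemLp.mul (p := 2) (q := ∞) G.memLp_BI (MatMemLp.const _ _)
  have hBIU2 : MatMemLp (fun θ => G.BI θ * U2 n) 2 (mu a b) :=
    MatMemLp.mul (p := 2) (q := ∞) G.memLp_BI (MatMemLp.const _ _)
  have hBIT : MatMemLp (fun s => G.BI s * U2 n * Tmat n (s - a)) 2 (mu a b) :=
    MatMemLp.mul (p := 2) (q := ∞) hBIU2 (matMemLp_of_continuous _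
      ((continuous_Tmat n).comp (continuous_id.sub continuous_const)))
  have hQb : MatMemLp (fun θ => (Matrix.fromRows 0 (Qmat n (b - θ)) :
      Matrix (CIdx n ⊕ CIdx n) (StateIdx n) ℝ)) 2 (mu a b) :=
    (MatMemLp.const _ _).fromRows (matMemLp_of_continuous _
      ((continuous_Qmat n).comp (continuous_const.sub continuous_id)))
  have hBQ : MatMemLp (fun θ => G.BT * G.BQ θ) 2 (mu a b) :=
    MatMemLp.mul (p := ∞) (q := 2) (MatMemLp.const _ _) G.memLp_BQ
  -- the three summands of `B_T B_Q`
  have e1 : mv G.BT (∫ θ in a..b, mv (G.BQ θ) (f.D θ)) =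
      (∫ θ in a..b, mv (G.BI θ * U1 n) (f.D θ))
      + (∫ θ in a..b, mv (matInt θ b fun s => G.BI s * U2 n * Qmat n (s - θ)) (f.D θ))
      - mv G.B (∫ θ in a..b, mv (Matrix.fromRows 0 (Qmat n (b - θ)) :
          Matrix (CIdx n ⊕ CIdx n) (StateIdx n) ℝ) (f.D θ)) := by
    -- The term with `matInt` is expressed through the other terms of `B_T B_Q`, whose integrability
    -- is already known.
    have hpt : ∀ θ, mv (matInt θ b fun s => G.BI s * U2 n * Qmat n (s - θ)) (f.D θ) =
        mv (G.BT * G.BQ θ) (f.D θ) - mv (G.BI θ * U1 n) (f.D θ)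
          + mv G.B (mv (Matrix.fromRows 0 (Qmat n (b - θ)) :
          Matrix (CIdx n ⊕ CIdx n) (StateIdx n) ℝ) (f.D θ)) := fun θ => by
      rw [BQ, ← Matrix.mul_assoc, G.BT_mul_BTinv hadm, Matrix.one_mul, sub_mv, add_mv, mv_mv]
      exact (show ∀ x y z : Vec (Fin nBC), x = y + x - z - y + z by intros; abel) _ _ _
    have hB : IntervalIntegrable (fun θ => mv G.B (mv (Matrix.fromRows 0 (Qmat n (b - θ)) :
          Matrix (CIdx n ⊕ CIdx n) (StateIdx n) ℝ) (f.D θ))) volume a b := by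
      simpa only [mv_mv] using
        ii (MatMemLp.mul (p := ∞) (q := 2) (MatMemLp.const _ G.B) hQb)
    simp only [hpt]
    rw [intervalIntegral.integral_add ((ii hBQ).sub (ii hBIU1)) hB,
      intervalIntegral.integral_sub (ii hBQ) (ii hBIU1), mv_intervalIntegral _ (ii hQb),
      mv_intervalIntegral _ (ii G.memLp_BQ)]
    simp only [mv_mv]
    abel
  -- the integral in the boundary conditions
  have e2 : ∫ s in a..b, mv (G.BI s) (f.F s) =
      (∫ θ in a..b, mv (G.BI θ * U1 n) (f.D θ))
      + ((∫ s in a..b, mv (G.BI s * U2 n * Tmat n (s - a)) (f.C a))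
      + ∫ θ in a..b, mv (matInt θ b fun s => G.BI s * U2 n * Qmat n (s - θ)) (f.D θ)) := by
    have hC : IntervalIntegrable (fun s => mv (G.BI s * U2 n) (f.C s)) volume a b :=
      integrable_intervalIntegrable (integrable_mv hBIU2 f.memLp_C) hl hr
    have hT : IntervalIntegrable (fun s => mv (G.BI s * U2 n * Tmat n (s - a)) (f.C a))
        volume a b :=
      integrable_intervalIntegrable (integrable_mv hBIT (memLp_const _)) hl hr
    rw [← integral_mv_triangle hab hBIU2 (continuous_Qmat n) f.memLp_D]
    -- Replacing the Taylor remainder by `C f(s) - T(s - a) C f(a)` makes both pieces visibly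
    -- integrable.
    have e3 : ∫ s in a..b, mv (G.BI s * U2 n) (∫ θ in a..s, mv (Qmat n (s - θ)) (f.D θ)) =
        ∫ s in a..b, (mv (G.BI s * U2 n) (f.C s)
          - mv (G.BI s * U2 n * Tmat n (s - a)) (f.C a)) := by
      refine intervalIntegral.integral_congr fun s hs => ?_
      rw [uIcc_of_le hab] at hs
      simp only [f.C_eq hs, mv_add, mv_mv]
      abel
    rw [e3, intervalIntegral.integral_sub hC hT, add_sub_cancel,
      ← intervalIntegral.integral_add (ii hBIU1) hC]
    refine intervalIntegral.integral_congr fun s _ => ?_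
    simp only [f.F_eq, mv_add, mv_mv]
  have e4 : mv G.BT (f.C a) =
      mv G.B (mv (Matrix.fromRows (Tmat n 0) (Tmat n (b - a))) (f.C a))
      - ∫ s in a..b, mv (G.BI s * U2 n * Tmat n (s - a)) (f.C a) := by
    rw [BT, sub_mv, mv_mv, matInt_mv fun i j =>
      integrable_intervalIntegrable (hBIT.integrable i j) hl hr]
  have e5 : (∫ s in a..b, mv (G.BI s) (f.F s)) + mv G.Bv v - mv G.B f.Bd = 0 := hf
  rw [e2, f.Bd_eq hab, mv_add] at e5
  -- Up to sign, the difference of the two sides is the boundary condition.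
  rw [e1, e4, ← sub_eq_zero, ← neg_eq_zero, ← e5]
  abel

/-- The boundary values at `a` in terms of the highest derivatives. -/
theorem C_left_eq (hab : a ≤ b) (hadm : G.Admissible) (hf : f ∈ G.X v) :
    f.C a = mv (G.BTinv * G.Bv) v + ∫ θ in a..b, mv (G.BQ θ) (f.D θ) := by
  have h := congrArg (mv G.BTinv) (BT_mv_C hab hadm hf)
  simpa only [mv_add, mv_mv, G.BTinv_mul_BT hadm, one_mv] using h

/-- In Taylor's formula at `s`, the integral that represents `C f(a)` is split at `s`. Its part over
`[a, s]` merges with the remainder, which is why the lower kernels carry the extra `Q` term. The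
free matrix `M` covers the uses with `U2`, `E1` and the identity. -/
theorem mv_C_eq (hadm : G.Admissible) (hf : f ∈ G.X v) {s : ℝ}
    (hs : s ∈ Icc a b) {l : Type} [Fintype l] (M : Matrix l (CIdx n) ℝ) :
    mv M (f.C s) = mv (M * Tmat n (s - a) * (G.BTinv * G.Bv)) v
      + ((∫ θ in a..s, mv (M * Qmat n (s - θ) + M * Tmat n (s - a) * G.BQ θ) (f.D θ))
      + ∫ θ in s..b, mv (M * Tmat n (s - a) * G.BQ θ) (f.D θ)) := by
  have hab : a ≤ b := hs.1.trans hs.2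
  have hl : a ∈ Icc a b := ⟨le_rfl, hab⟩
  have hr : b ∈ Icc a b := ⟨hab, le_rfl⟩
  have hBQ : MatMemLp (fun θ => M * Tmat n (s - a) * G.BQ θ) 2 (mu a b) :=
    MatMemLp.mul (p := ∞) (q := 2) (MatMemLp.const _ _) G.memLp_BQ
  have hQ : MatMemLp (fun θ => M * Qmat n (s - θ)) 2 (mu a b) :=
    MatMemLp.mul (p := ∞) (q := 2) (MatMemLp.const _ _) (matMemLp_of_continuous _
      ((continuous_Qmat n).comp (continuous_const.sub continuous_id)))
  have ii {c d : ℝ} (hc : c ∈ Icc a b) (hd : d ∈ Icc a b) {k : Type} [Fintype k]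
      {K : ℝ → Matrix k (StateIdx n) ℝ} (hK : MatMemLp K 2 (mu a b)) :
      IntervalIntegrable (fun θ => mv (K θ) (f.D θ)) volume c d :=
    integrable_intervalIntegrable (integrable_mv hK f.memLp_D) hc hd
  simp only [add_mv]
  rw [intervalIntegral.integral_add (ii hl hs hQ) (ii hl hs hBQ), add_assoc,
    intervalIntegral.integral_add_adjacent_intervals (ii hl hs hBQ) (ii hs hr hBQ), f.C_eq hs,
    C_left_eq hab hadm hf, mv_add, mv_add, mv_add, mv_mv, mv_mv, mv_mv,
    mv_intervalIntegral _ (ii hl hr G.memLp_BQ),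
    mv_intervalIntegral _ (integrable_intervalIntegrable (f.integrable_Q_D s) hl hs)]
  simp only [mv_mv, Matrix.mul_assoc]
  abel

/-- `Υ` maps `(v, D f)` to `((v, B f), F f)`. -/
theorem Upsilon_op_eq (hab : a ≤ b) (hadm : G.Admissible) (hf : f ∈ G.X v) :
    G.Upsilon.op (WithLp.toLp 2 (v, f.memLp_D.toLp f.D)) =
      WithLp.toLp 2 (WithLp.toLp 2 (Sum.elim v f.Bd), f.memLp_F.toLp f.F) := by
  have hl : a ∈ Icc a b := ⟨le_rfl, hab⟩
  have hr : b ∈ Icc a b := ⟨hab, le_rfl⟩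
  refine FourPIParams.op_eq hab _ _ ?_ ?_
  · have hint := integrable_intervalIntegrable
      (integrable_mv G.Upsilon.memLp_Q1 f.memLp_D) hl hr
    have hBQ := integrable_intervalIntegrable (integrable_mv G.memLp_BQ f.memLp_D) hl hr
    ext (i | i | i)
    · rw [PiLp.add_apply, intervalIntegral_apply hint]
      have e1 : ∀ θ, mv (G.Upsilon.Q1 θ) (f.D θ) (Sum.inl i) = 0 := fun θ => by
        simp [mv_apply, Upsilon]
      have e2 : mv G.Upsilon.P v (Sum.inl i) = mv (1 : Matrix (Fin nv) (Fin nv) ℝ) v i := rfl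
      simp only [e1, e2, one_mv, intervalIntegral.integral_zero, add_zero]
      rfl
    · have h := congrArg (fun x : Vec (CIdx n) => x i) (C_left_eq hab hadm hf)
      simp only [PiLp.add_apply] at h
      rw [intervalIntegral_apply hBQ] at h
      rw [PiLp.add_apply, intervalIntegral_apply hint]
      exact h
    · have hC := mv_C_eq hadm hf hr (1 : Matrix (CIdx n) (CIdx n) ℝ)
      simp only [one_mv, Matrix.one_mul, intervalIntegral.integral_same, add_zero] at hC
      have h := congrArg (fun x : Vec (CIdx n) => x i) hC
      simp only [PiLp.add_apply] at h
      have hK : MatMemLp (fun θ => Qmat n (b - θ) + Tmat n (b - a) * G.BQ θ) 2 (mu a b) :=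
        (matMemLp_of_continuous _
          ((continuous_Qmat n).comp (continuous_const.sub continuous_id))).add
          (MatMemLp.mul (p := ∞) (q := 2) (MatMemLp.const _ _) G.memLp_BQ)
      rw [intervalIntegral_apply
        (integrable_intervalIntegrable (integrable_mv hK f.memLp_D) hl hr)] at h
      rw [PiLp.add_apply, intervalIntegral_apply hint]
      refine h.trans (congrArg _ (intervalIntegral.integral_congr fun θ _ => ?_))
      simp only [add_comm (Qmat n (b - θ))]
      rfl
  · filter_upwards [f.memLp_F.coeFn_toLp, ae_restrict_mem measurableSet_Icc] with s hs hm
    have h := mv_C_eq hadm hf hm (U2 n)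
    rw [hs, f.F_eq, h]
    simp only [Upsilon, RD1, RD2, add_comm (U2 n * Tmat n (s - a) * G.BQ _)]
    abel

/-- The distributed state is recovered from its highest derivatives and the boundary input. -/
theorem Tv_add_That_eq (hadm : G.Admissible) (hf : f ∈ G.X v) :
    G.Tv v + G.That (f.memLp_D.toLp f.D) = f.toL2 := by
  refine funcOp_add_threePI_eq _ _ _ _ _ _ ?_
  have hv : ∀ᵐ s ∂(mu a b), f.toL2 s = WithLp.toLp 2 fun p => f.1 p s := f.memLp.coeFn_toLp
  filter_upwards [hv, ae_restrict_mem measurableSet_Icc] with s hs hm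
  rw [hs, f.val_eq, mv_C_eq hadm hf hm (E1 n)]
  simp only [Gv, G1, G2]
  abel

end BCParams

end

/-! ### Block operators and curves in product spaces. -/

/-- `pieA` is assembled from the separate blocks of `subsystemOp`; by linearity these recombine into
one application of the operator to `(C_v x, D f)`. -/
theorem toLp_block_add {E F E' F' : Type} [NormedAddCommGroup E] [NormedSpace ℝ E]
    [NormedAddCommGroup F] [NormedSpace ℝ F] [NormedAddCommGroup E'] [NormedSpace ℝ E']
    [NormedAddCommGroup F'] [NormedSpace ℝ F'] (S : WithLp 2 (E × F) →L[ℝ] WithLp 2 (E' × F'))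
    (x : E) (y : F) :
    WithLp.toLp 2 (block11 S x + block12 S y, block21 S x + block22 S y)
      = S (WithLp.toLp 2 (x, y)) := by
  have h : S (WithLp.toLp 2 (x, y)) = S (WithLp.toLp 2 (x, 0)) + S (WithLp.toLp 2 (0, y)) := by
    rw [← map_add, ← WithLp.toLp_add]
    simp
  rw [h]
  rfl

/-- Increments in the `ℓ²` product are at most the sum of the increments of the components, since
`√(p² + q²) ≤ p + q` for nonnegative `p`, `q`. -/
theorem _root_.AbsolutelyContinuousOnInterval.toLp_prodMk {E F : Type} [NormedAddCommGroup E]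
    [NormedAddCommGroup F] {f : ℝ → E} {g : ℝ → F} {c d : ℝ}
    (hf : AbsolutelyContinuousOnInterval f c d) (hg : AbsolutelyContinuousOnInterval g c d) :
    AbsolutelyContinuousOnInterval (fun t => WithLp.toLp 2 (f t, g t)) c d := by
  refine squeeze_zero (fun _ => Finset.sum_nonneg fun _ _ => dist_nonneg) (fun E => ?_)
    (by simpa using Filter.Tendsto.add hf hg)
  rw [← Finset.sum_add_distrib]
  refine Finset.sum_le_sum fun i _ => ?_
  rw [WithLp.prod_dist_eq_of_L2]
  refine Real.sqrt_le_iff.2 ⟨by positivity, ?_⟩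
  have h := mul_nonneg (dist_nonneg (x := f (E.2 i).1) (y := f (E.2 i).2))
    (dist_nonneg (x := g (E.2 i).1) (y := g (E.2 i).2))
  rw [WithLp.toLp_fst, WithLp.toLp_fst, WithLp.toLp_snd, WithLp.toLp_snd]
  nlinarith

theorem _root_.HasDerivAt.toLp_prodMk {E F : Type} [NormedAddCommGroup E] [NormedSpace ℝ E]
    [NormedAddCommGroup F] [NormedSpace ℝ F] {f : ℝ → E} {g : ℝ → F} {f' : E} {g' : F} {t : ℝ}
    (hf : HasDerivAt f f' t) (hg : HasDerivAt g g' t) :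
    HasDerivAt (fun t => WithLp.toLp 2 (f t, g t)) (WithLp.toLp 2 (f', g')) t :=
  (WithLp.prodContinuousLinearEquiv 2 ℝ E F).symm.hasFDerivAt.comp_hasDerivAt t (hf.prodMk hg)

theorem mv_fromCols {m n l : Type} [Fintype m] [Fintype n] [Fintype l]
    (M : Matrix l m ℝ) (M' : Matrix l n ℝ) (x : Vec m) (y : Vec n) :
    mv (Matrix.fromCols M M') (WithLp.toLp 2 (Sum.elim x y)) = mv M x + mv M' y := by
  ext i
  simp [mv_apply]

/-! ### The PIE operators evaluated on GPDE states. -/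

section Model

variable {N : ℕ} {n : Fin (N + 1) → ℕ} {nx nw nu nr nz ny nv nBC : ℕ} {a b : ℝ}
  {Go : ODEParams nx nw nu nr nz ny nv} {Gb : BCParams a b n nBC nv} {Gp : PDEParams a b n nv nr}

theorem pieT_eq (hadm : Gb.Admissible) {x : Vec (Fin nx)} {f : Wn a b n}
    (hf : f ∈ Gb.X (mv Go.Cv x)) :
    pieT Go Gb (WithLp.toLp 2 (x, f.memLp_D.toLp f.D)) = toRL2 x f := by
  have h := Gb.Tv_add_That_eq hadm hf
  exact congrArg (WithLp.toLp 2) (Prod.ext (add_zero x) h)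

/-- `Υ` rebuilds the boundary values and all derivatives from `(v, D f)`, and `Ξ` applies the
in-domain dynamics to them. -/
theorem subsystemOp_eq (hab : a ≤ b) (hadm : Gb.Admissible) {v : Vec (Fin nv)} {f : Wn a b n}
    (hf : f ∈ Gb.X v) {r : Vec (Fin nr)} {d : L2 a b (StateIdx n)}
    (hr : r = (∫ θ in a..b, mv (Gp.Cr θ) (f.F θ)) + mv Gp.Drb f.Bd)
    (hd : ∀ᵐ s ∂(mu a b), d s = mv (Gp.A0 s) (f.F s) + mv (Gp.Bxv s) v + mv (Gp.Bxb s) f.Bd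
        + (∫ θ in a..s, mv (Gp.A1 s θ) (f.F θ)) + ∫ θ in s..b, mv (Gp.A2 s θ) (f.F θ)) :
    subsystemOp Gb Gp (WithLp.toLp 2 (v, f.memLp_D.toLp f.D)) = WithLp.toLp 2 (r, d) := by
  rw [subsystemOp, ContinuousLinearMap.comp_apply, Gb.Upsilon_op_eq hab hadm hf]
  refine FourPIParams.op_eq hab _ _ ?_ ?_
  · rw [hr]
    simp only [PDEParams.Xi, mv_fromCols, zero_mv, zero_add]
    exact add_comm _ _
  · filter_upwards [hd] with s hs
    rw [hs]
    simp only [PDEParams.Xi, mv_fromCols]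
    abel

/-- Here `d` is any class that satisfies the PDE formula, so along a solution it can be the time
derivative of the distributed state. -/
theorem pieA_eq (hab : a ≤ b) (hadm : Gb.Admissible) {x : Vec (Fin nx)} {f : Wn a b n}
    (hf : f ∈ Gb.X (mv Go.Cv x)) {r : Vec (Fin nr)} {d : L2 a b (StateIdx n)}
    (hr : r = (∫ θ in a..b, mv (Gp.Cr θ) (f.F θ)) + mv Gp.Drb f.Bd)
    (hd : ∀ᵐ s ∂(mu a b), d s = mv (Gp.A0 s) (f.F s) + mv (Gp.Bxv s) (mv Go.Cv x)
        + mv (Gp.Bxb s) f.Bd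
        + (∫ θ in a..s, mv (Gp.A1 s θ) (f.F θ)) + ∫ θ in s..b, mv (Gp.A2 s θ) (f.F θ)) :
    pieA Go Gb Gp (WithLp.toLp 2 (x, f.memLp_D.toLp f.D))
      = WithLp.toLp 2 (mv Go.A x + mv Go.Bxr r, d) := by
  have h := (toLp_block_add _ _ _).trans (subsystemOp_eq hab hadm hf hr hd)
  have h' := congrArg WithLp.ofLp h
  have h1 : block11 (subsystemOp Gb Gp) (mv Go.Cv x)
      + block12 (subsystemOp Gb Gp) (f.memLp_D.toLp f.D) = r := congrArg Prod.fst h'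
  have h2 : block21 (subsystemOp Gb Gp) (mv Go.Cv x)
      + block22 (subsystemOp Gb Gp) (f.memLp_D.toLp f.D) = d := congrArg Prod.snd h'
  refine congrArg (WithLp.toLp 2) (Prod.ext ?_ h2)
  rw [← h1, mv_add, ← add_assoc]
  rfl

/-- The quadratic form of the Lyapunov operator inequality `A* P T + T* P A ≤ -δ T* T`. -/
theorem inner_le_of_lyapunov_le {H K : Type} [NormedAddCommGroup H] [InnerProductSpace ℝ H]
    [CompleteSpace H] [NormedAddCommGroup K] [InnerProductSpace ℝ K] [CompleteSpace K]
    {A T : K →L[ℝ] H} {P : H →L[ℝ] H} (hP : ∀ x y, inner ℝ (P x) y = inner ℝ x (P y)) {δ : ℝ}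
    (h : ContinuousLinearMap.adjoint A ∘L P ∘L T + ContinuousLinearMap.adjoint T ∘L P ∘L A
      ≤ -(δ • (ContinuousLinearMap.adjoint T ∘L T))) (φ : K) :
    2 * inner ℝ (P (T φ)) (A φ) ≤ -δ * ‖T φ‖ ^ 2 := by
  rw [ContinuousLinearMap.le_def] at h
  have h1 := h.inner_nonneg_left φ
  simp only [sub_apply, neg_apply,
    smul_apply, add_apply,
    ContinuousLinearMap.comp_apply, inner_sub_left, inner_neg_left, inner_add_left,
    real_inner_smul_left, ContinuousLinearMap.adjoint_inner_left, real_inner_self_eq_norm_sq] at h1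
  -- Once the adjoints are moved across, symmetry of `P` identifies the two halves of the Lyapunov
  -- expression.
  have e : inner ℝ (P (A φ)) (T φ) = inner ℝ (P (T φ)) (A φ) := by
    rw [hP, real_inner_comm]
  linarith

end Model

end GPDE

/-! ### Exponential stability. -/

theorem theorem5 {N : ℕ} (n : Fin (N + 1) → ℕ) {nx nw nu nr nz ny nv nBC : ℕ} {a b : ℝ} (hab : a < b)
    (Go : GPDE.ODEParams nx nw nu nr nz ny nv) (Gb : GPDE.BCParams a b n nBC nv)
    (Gp : GPDE.PDEParams a b n nv nr) (hadm : Gb.Admissible) (ε δ : ℝ) (hε : 0 < ε) (hδ : 0 < δ)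
    (P : GPDE.RL2 a b (Fin nx) (GPDE.StateIdx n) →L[ℝ] GPDE.RL2 a b (Fin nx) (GPDE.StateIdx n))
    (hPI : GPDE.IsFourPI P) (hsa : IsSelfAdjoint P) (hPε : ε • ContinuousLinearMap.id ℝ _ ≤ P)
    (hLPI : ContinuousLinearMap.adjoint (GPDE.pieA Go Gb Gp) ∘L P ∘L GPDE.pieT Go Gb
        + ContinuousLinearMap.adjoint (GPDE.pieT Go Gb) ∘L P ∘L GPDE.pieA Go Gb Gp
      ≤ -(δ • (ContinuousLinearMap.adjoint (GPDE.pieT Go Gb) ∘L GPDE.pieT Go Gb))) :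
    GPDE.ExpStableRL2 Go Gb Gp := by
  have hP : ∀ x y, inner ℝ (P x) y = inner ℝ x (P y) := fun x y => hsa.isSymmetric x y
  have hlow : ∀ x, ε * ‖x‖ ^ 2 ≤ inner ℝ (P x) x := fun x => by
    rw [ContinuousLinearMap.le_def] at hPε
    have h := hPε.inner_nonneg_left x
    simp only [sub_apply, smul_apply,
      ContinuousLinearMap.id_apply, inner_sub_left, real_inner_smul_left,
      real_inner_self_eq_norm_sq] at h
    linarith
  -- The constants depend only on `P`, `ε` and `δ`, hence are uniform over all solutions.
  refine ⟨√((‖P‖ + 1) / ε), δ / (‖P‖ + 1) / 2, by positivity, by positivity, ?_⟩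
  intro x0 xh0 _ x xh z y v r hsol t ht
  have hX : GPDE.LocAC fun t => GPDE.toRL2 (x t) (xh t) := fun T hT =>
    (hsol.x_ac T hT).toLp_prodMk (hsol.xh_ac T hT)
  -- With `w = u = 0` the constraint on the state holds at every `t ≥ 0` with boundary input `C_v
  -- x(t)`; the output `v` itself equals it only almost everywhere.
  have hmem : ∀ t, 0 ≤ t → xh t ∈ Gb.X (GPDE.mv Go.Cv (x t)) := fun t ht => by
    simpa [GPDE.domX, GPDE.mv_zero] using hsol.mem_domX t ht
  have hd : ∀ᵐ t ∂(MeasureTheory.volume.restrict (Set.Ici 0)), ∃ d,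
      HasDerivAt (fun t => GPDE.toRL2 (x t) (xh t)) d t ∧
        2 * inner ℝ (P (GPDE.toRL2 (x t) (xh t))) d ≤ -δ * ‖GPDE.toRL2 (x t) (xh t)‖ ^ 2 := by
    filter_upwards [hsol.ode, hsol.pde, hsol.out_v, hsol.out_r,
      MeasureTheory.ae_restrict_mem measurableSet_Ici] with t hode ⟨d, hpde, hds⟩ hv hr ht
    simp only [GPDE.mv_zero, add_zero] at hode hv
    rw [hv] at hds
    have hA := GPDE.pieA_eq hab.le hadm (hmem t ht) hr hds
    have hT := GPDE.pieT_eq hadm (hmem t ht)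
    refine ⟨_, hode.toLp_prodMk hpde, ?_⟩
    -- The operator inequality is tested at the frozen-time vector `(x(t), D f(t))`, so no
    -- regularity of `D f` in time is needed.
    have h := GPDE.inner_le_of_lyapunov_le hP hLPI
      (WithLp.toLp 2 (x t, (xh t).memLp_D.toLp (xh t).D))
    rw [hA, hT] at h
    exact h
  -- The initial distributed state is prescribed only as a class in `L₂`, which is all that the norm
  -- sees.
  have h0 : GPDE.toRL2 (x 0) (xh 0) = GPDE.toRL2 x0 xh0 := by
    rw [GPDE.toRL2, GPDE.toRL2, hsol.x_initial, hsol.xh_initial]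
  rw [← h0]
  exact GPDE.norm_le_of_lyapunov hP hε hδ hlow hX hd ht
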